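/- Let $(X,Y)$ be a pair of real random variables with $Y\ge 0$ almost surely. Let $G$ be the Gumbel law $\Lambda(x)=\exp(-e^{-x})$ or a Fréchet law $\Phi_\beta(x)=\exp(-x^{-\beta})\mathbf 1_{\{x>0\}}$, $\beta>0$, and assume that $X$ belongs to the maximum domain of attraction of $G$: there are functions $a>0$ and $b$ with $$tP(X>a(t)x+b(t))\to-\log G(x)\in[0,\infty]\qquad(t\to\infty)$$ for every $x\in\mathbb R$. Assume that $Y$ has a regularly varying tail of index $\alpha\in(0,1)$, i.e. $P(Y>ct)/P(Y>t)\to c^{-\alpha}$ as $t\to\infty$ for every $c>0$. Let $d_0=0$, let $d_n>0$ $(n\ge1)$ satisfy $nP(Y>d_n)\to1$, put $d(t)=d_{\lfloor t\rfloor}$, and let $\widetilde d$ be an asymptotic inverse of $d$, i.e. $d(\widetilde d(t))\sim\widetilde d(d(t))\sim t$ as $t\to\infty$. Put $$\widetilde X_t=\frac{X-b(\widetilde d(t))}{a(\widetilde d(t))},\qquad \widetilde Y_t=\frac{Y}{t}.$$ Let $\mathbb E=[-\infty,\infty]\times[0,\infty]\setminus\{(-\infty,0)\}$ if $G=\Lambda$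 and $\mathbb E=[0,\infty]^2\setminus\{(0,0)\}$ if $G=\Phi_\beta$. Let $$C=\{(u,v)\in\mathbb R\times(0,\infty):e^{-u}=v^{-\alpha}\}\ \text{ if } G=\Lambda,\qquad C=\{(u,v)\in(0,\infty)^2:u^{-\beta}=v^{-\alpha}\}\ \text{ if } G=\Phi_\beta,$$ and let $\mu_0$ be the measure on $\mathbb E$ that is concentrated on $C$ and satisfies $\mu_0(\{(u,v)\in C:v>y\})=y^{-\alpha}$ for all $y>0$. For $Z\in\{X,Y\}$ with distribution function $F_Z$ put $U_Z=1/(1-F_Z)$ (with value $\infty$ where $F_Z=1$) and $U_Z^{\leftarrow}(x)=\inf\{s\in\mathbb R:U_Z(s)>x\}$. Then the vague convergence on $\mathbb E$ $$\widetilde d(t)\,P\big((\widetilde X_t,\widetilde Y_t)\in\cdot\big)\xrightarrow{\;v\;}\mu_0(\cdot)\qquad(t\to\infty),$$ i.e. convergence of the integrals of all continuous compactly supported functions on $\mathbb E$ (with respect to the restrictions of these measures to $\mathbb E$), holds if and only if $$\lim_{x\to\infty}P\big(X>U_X^{\leftarrow}(x)\,\big|\,Y>U_Y^{\leftarrow}(x)\big)=1.$$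 -/

import Mathlib

open MeasureTheory ProbabilityTheory Filter Topology Set Asymptotics
open scoped ENNReal CompactlySupported

noncomputable section

namespace FullTailDependence

/-- The extreme value laws of the observations: the Gumbel law and the Fréchet laws of
index `β > 0`. -/
inductive ExtremeLaw where
  | gumbel : ExtremeLaw
  | frechet (β : ℝ) (hβ : 0 < β) : ExtremeLaw

namespace ExtremeLaw

/-- The distribution function of the law. -/
def distFun : ExtremeLaw → ℝ → ℝ
  | gumbel, x => Real.exp (-Real.exp (-x))
  | frechet β _, x => if x ≤ 0 then 0 else Real.exp (-x ^ (-β))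

/-- `-log G(x)`, with values in `[0, ∞]` (it is `∞` where `G(x) = 0`). -/
def negLog (G : ExtremeLaw) (x : ℝ) : EReal :=
  -ENNReal.log (ENNReal.ofReal (G.distFun x))

/-- The state space of the marks, with the topology induced by the compact product
`[-∞, ∞] × [-∞, ∞]`:
`[-∞, ∞] × [0, ∞] ∖ {(-∞, 0)}` in the Gumbel case,
`[0, ∞] × [0, ∞] ∖ {(0, 0)}` in the Fréchet case. -/
def stateSpace : ExtremeLaw → Set (EReal × EReal)
  | gumbel => {p | 0 ≤ p.2 ∧ p ≠ (⊥, 0)}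
  | frechet _ _ => {p | 0 ≤ p.1 ∧ 0 ≤ p.2 ∧ p ≠ (0, 0)}

/-- The curve `C` on which the limit measure lives. -/
def curve (α : ℝ) : ExtremeLaw → Set (EReal × EReal)
  | gumbel => {p | ∃ u v : ℝ, 0 < v ∧ Real.exp (-u) = v ^ (-α) ∧ p = ((u : EReal), (v : EReal))}
  | frechet β _ => {p | ∃ u v : ℝ, 0 < u ∧ 0 < v ∧ u ^ (-β) = v ^ (-α) ∧
      p = ((u : EReal), (v : EReal))}

/-- The first coordinate of the point of `C` with second coordinate `v > 0`. -/
def curveFst (α : ℝ) : ExtremeLaw → ℝ → ℝ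
  | gumbel, v => α * Real.log v
  | frechet β _, v => v ^ (α / β)

/-- The point of `C` with second coordinate `v > 0`. -/
def curvePoint (α : ℝ) (G : ExtremeLaw) (v : ℝ) : EReal × EReal :=
  ((G.curveFst α v : EReal), (v : EReal))

end ExtremeLaw

/-- The measure on `(0, ∞)` with `(y, ∞) ↦ y ^ (-α)`. -/
def paretoMeasure (α : ℝ) : Measure ℝ :=
  (volume.restrict (Ioi 0)).withDensity fun v => ENNReal.ofReal (α * v ^ (-α - 1))

/-- The exponent measure `μ₀` of full tail dependence: the measure on the state space that is
concentrated on `C` and gives mass `y ^ (-α)` to `{(u, v) ∈ C | v > y}` for `y > 0`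
(see `exponentMeasure_curve_compl` and `exponentMeasure_curve_Ioi`). -/
def exponentMeasure (α : ℝ) (G : ExtremeLaw) : Measure G.stateSpace :=
  ((paretoMeasure α).map (G.curvePoint α)).comap Subtype.val

section facts

namespace ExtremeLaw

lemma measurableSet_stateSpace (G : ExtremeLaw) : MeasurableSet G.stateSpace := by
  cases G with
  | gumbel =>
    exact (measurableSet_le measurable_const measurable_snd).inter
      (measurableSet_singleton _).compl
  | frechet β hβ =>
    exact (measurableSet_le measurable_const measurable_fst).inter
      ((measurableSet_le measurable_const measurable_snd).inter
        (measurableSet_singleton _).compl)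

lemma measurable_curvePoint (α : ℝ) (G : ExtremeLaw) : Measurable (G.curvePoint α) := by
  have h : Measurable (G.curveFst α) := by
    cases G with
    | gumbel => exact Real.measurable_log.const_mul α
    | frechet β hβ => exact measurable_id.pow_const _
  exact (measurable_coe_real_ereal.comp h).prodMk measurable_coe_real_ereal

/-- `C` is the image of `(0, ∞)` under `curvePoint`. -/
lemma mem_curve_iff (α : ℝ) (G : ExtremeLaw) (p : EReal × EReal) :
    p ∈ G.curve α ↔ ∃ v : ℝ, 0 < v ∧ p = G.curvePoint α v := by
  cases G with
  | gumbel =>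
    constructor
    · rintro ⟨u, v, hv, h, rfl⟩
      refine ⟨v, hv, ?_⟩
      have h2 := congrArg Real.log h
      rw [Real.log_exp, Real.log_rpow hv] at h2
      have h3 : u = α * Real.log v := by linarith
      rw [h3]; rfl
    · rintro ⟨v, hv, rfl⟩
      refine ⟨α * Real.log v, v, hv, ?_, rfl⟩
      rw [Real.rpow_def_of_pos hv]
      congr 1; ring
  | frechet β hβ =>
    constructor
    · rintro ⟨u, v, hu, hv, h, rfl⟩
      refine ⟨v, hv, ?_⟩
      have h3 : u = v ^ (α / β) := by
        have h2 := congrArg (fun z : ℝ => z ^ (-(1 / β))) h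
        rw [← Real.rpow_mul hu.le, ← Real.rpow_mul hv.le] at h2
        have e1 : -β * -(1 / β) = 1 := by field_simp
        have e2 : -α * -(1 / β) = α / β := by field_simp
        rwa [e1, e2, Real.rpow_one] at h2
      simp [curvePoint, curveFst, h3]
    · rintro ⟨v, hv, rfl⟩
      refine ⟨v ^ (α / β), v, Real.rpow_pos_of_pos hv _, hv, ?_, rfl⟩
      rw [← Real.rpow_mul hv.le]
      congr 1; field_simp

lemma curve_subset_stateSpace (α : ℝ) (G : ExtremeLaw) : G.curve α ⊆ G.stateSpace := by
  cases G with
  | gumbel =>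
    rintro _ ⟨u, v, hv, -, rfl⟩
    exact ⟨EReal.coe_nonneg.2 hv.le, by simp⟩
  | frechet β hβ =>
    rintro _ ⟨u, v, hu, hv, -, rfl⟩
    exact ⟨EReal.coe_nonneg.2 hu.le, EReal.coe_nonneg.2 hv.le, by simp [hu.ne']⟩

end ExtremeLaw

lemma paretoMeasure_Ioi {α : ℝ} (hα : 0 < α) {y : ℝ} (hy : 0 < y) :
    paretoMeasure α (Ioi y) = ENNReal.ofReal (y ^ (-α)) := by
  have hi := (integrableOn_Ioi_rpow_of_lt (a := -α - 1) (by linarith) hy).const_mul α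
  rw [paretoMeasure, withDensity_apply _ measurableSet_Ioi,
    Measure.restrict_restrict measurableSet_Ioi,
    inter_eq_left.2 (Ioi_subset_Ioi hy.le),
    ← ofReal_integral_eq_lintegral_ofReal hi, integral_const_mul,
    integral_Ioi_rpow_of_lt (by linarith) hy]
  · congr 1
    have : -α - 1 + 1 = -α := by ring
    rw [this]
    field_simp
  · filter_upwards [ae_restrict_mem measurableSet_Ioi] with v hv
    have : 0 < v := hy.trans hv
    positivity

lemma paretoMeasure_Iic (α : ℝ) : paretoMeasure α (Iic 0) = 0 := by
  rw [paretoMeasure, withDensity_apply _ measurableSet_Iic,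
    Measure.restrict_restrict measurableSet_Iic, Iic_inter_Ioi, Ioc_self,
    Measure.restrict_empty, lintegral_zero_measure]

lemma exponentMeasure_apply (α : ℝ) (G : ExtremeLaw) {S : Set G.stateSpace}
    (hS : MeasurableSet S) :
    exponentMeasure α G S = paretoMeasure α (G.curvePoint α ⁻¹' (Subtype.val '' S)) := by
  rw [exponentMeasure, comap_subtype_coe_apply G.measurableSet_stateSpace,
    Measure.map_apply (G.measurable_curvePoint α)
      (G.measurableSet_stateSpace.subtype_image hS)]

/-- `μ₀` is concentrated on the curve `C`. -/
lemma exponentMeasure_curve_compl (α : ℝ) (G : ExtremeLaw) :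
    exponentMeasure α G {p | (p : EReal × EReal) ∉ G.curve α} = 0 := by
  have hsub : {p : G.stateSpace | (p : EReal × EReal) ∉ G.curve α} ⊆
      {p : G.stateSpace | ∀ r : ℝ, 0 < r → p.1.2 = r → False} ∪
      {p : G.stateSpace | p.1 ≠ G.curvePoint α p.1.2.toReal} := by
    intro p hp
    by_contra hcon
    simp only [mem_union, mem_ofPred_eq, not_or, not_forall, not_not] at hcon
    obtain ⟨⟨r, hr, hpr, -⟩, h2⟩ := hcon
    refine hp ((G.mem_curve_iff α _).2 ⟨r, hr, ?_⟩)
    rw [hpr, EReal.toReal_coe] at h2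
    exact h2
  refine measure_mono_null hsub (measure_union_null ?_ ?_)
  · have hm : MeasurableSet {p : G.stateSpace | ∀ r : ℝ, 0 < r → p.1.2 = r → False} := by
      have : {p : G.stateSpace | ∀ r : ℝ, 0 < r → p.1.2 = r → False} =
          (fun p : G.stateSpace => p.1.2) ⁻¹' (Ioo 0 ⊤)ᶜ := by
        ext p
        simp only [mem_ofPred_eq, mem_preimage, mem_compl_iff]
        constructor
        · rintro h ⟨h0, h1⟩
          refine h p.1.2.toReal (EReal.toReal_pos h0 h1.ne) ?_
          rw [EReal.coe_toReal h1.ne (ne_bot_of_gt h0)]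
        · intro h r hr hpr
          rw [hpr] at h
          exact h ⟨EReal.coe_pos.2 hr, EReal.coe_lt_top r⟩
      rw [this]
      exact (measurable_snd.comp measurable_subtype_coe) measurableSet_Ioo.compl
    rw [exponentMeasure_apply α G hm]
    refine measure_mono_null ?_ (paretoMeasure_Iic α)
    rintro v ⟨p, hp, hpv⟩
    by_contra hv
    exact hp v (not_le.1 hv) (by rw [hpv]; rfl)
  · have hm : MeasurableSet {p : G.stateSpace | p.1 ≠ G.curvePoint α p.1.2.toReal} := by
      refine (measurableSet_eq_fun measurable_subtype_coe ?_).compl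
      exact (G.measurable_curvePoint α).comp
        (measurable_ereal_toReal.comp (measurable_snd.comp measurable_subtype_coe))
    rw [exponentMeasure_apply α G hm]
    convert! measure_empty (μ := paretoMeasure α)
    rw [eq_empty_iff_forall_notMem]
    rintro v ⟨p, hp, hpv⟩
    refine hp ?_
    rw [hpv]
    simp [ExtremeLaw.curvePoint]

/-- `μ₀ {(u, v) ∈ C | v > y} = y ^ (-α)` for `y > 0`. -/
lemma exponentMeasure_curve_Ioi {α : ℝ} (hα : 0 < α) (G : ExtremeLaw) {y : ℝ} (hy : 0 < y) :
    exponentMeasure α G {p | (p : EReal × EReal) ∈ G.curve α ∧ (y : EReal) < p.1.2} =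
      ENNReal.ofReal (y ^ (-α)) := by
  have hm : MeasurableSet {p : G.stateSpace | (y : EReal) < p.1.2} :=
    measurableSet_lt measurable_const (measurable_snd.comp measurable_subtype_coe)
  have h1 : exponentMeasure α G {p | (p : EReal × EReal) ∈ G.curve α ∧ (y : EReal) < p.1.2} =
      exponentMeasure α G {p : G.stateSpace | (y : EReal) < p.1.2} := by
    refine measure_congr ?_
    have : ∀ᵐ p : G.stateSpace ∂(exponentMeasure α G), (p : EReal × EReal) ∈ G.curve α :=
      exponentMeasure_curve_compl α G
    filter_upwards [this] with p hp
    exact propext ⟨fun h => h.2, fun h => ⟨hp, h⟩⟩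
  rw [h1, exponentMeasure_apply α G hm, ← paretoMeasure_Ioi hα hy]
  congr 1
  ext v
  constructor
  · rintro ⟨p, hp, hpv⟩
    simp only [mem_ofPred_eq, hpv, ExtremeLaw.curvePoint] at hp
    exact EReal.coe_lt_coe_iff.1 hp
  · intro hv
    have hv0 : 0 < v := hy.trans hv
    exact ⟨⟨G.curvePoint α v, G.curve_subset_stateSpace α
      ((G.mem_curve_iff α _).2 ⟨v, hv0, rfl⟩)⟩, EReal.coe_lt_coe_iff.2 hv, rfl⟩

end facts

/-- Vague convergence `m t → m₀` as `t → ∞`: convergence of the integrals of all continuous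
functions with compact support. -/
def VagueTendsto {E : Type*} [TopologicalSpace E] [MeasurableSpace E]
    (m : ℝ → Measure E) (m₀ : Measure E) : Prop :=
  ∀ f : C_c(E, ℝ), Tendsto (fun t => ∫ z, f z ∂(m t)) atTop (𝓝 (∫ z, f z ∂m₀))

variable {Ω : Type*} [MeasurableSpace Ω]

/-- `X` is in the maximum domain of attraction of `G`, with normalizing functions `a > 0` and `b`:
`t P(X > a(t) x + b(t)) → -log G(x)` as `t → ∞`, for every real `x`. -/
def IsInMDA (P : Measure Ω) (X : Ω → ℝ) (G : ExtremeLaw) (a b : ℝ → ℝ) : Prop :=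
  (∀ᶠ t in atTop, 0 < a t) ∧
  ∀ x : ℝ, Tendsto (fun t : ℝ => ((t * P.real {ω | a t * x + b t < X ω} : ℝ) : EReal)) atTop
    (𝓝 (G.negLog x))

/-- The tail of `Y` is regularly varying at infinity with index `-α`. -/
def IsRegVar (P : Measure Ω) (Y : Ω → ℝ) (α : ℝ) : Prop :=
  ∀ c : ℝ, 0 < c →
    Tendsto (fun t : ℝ => P.real {ω | c * t < Y ω} / P.real {ω | t < Y ω}) atTop (𝓝 (c ^ (-α)))

/-- The restriction to the state space of the law of the rescaled pair
`((X - b(d̃(t))) / a(d̃(t)), Y / t)`. -/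
def rescaledLaw (P : Measure Ω) (X Y : Ω → ℝ) (G : ExtremeLaw) (a b dinv : ℝ → ℝ) (t : ℝ) :
    Measure G.stateSpace :=
  (P.map fun ω => ((((X ω - b (dinv t)) / a (dinv t) : ℝ) : EReal),
    ((Y ω / t : ℝ) : EReal))).comap Subtype.val

/-- `U_X = 1 / (1 - F_X)`, with the value `∞` where `F_X = 1`. -/
def tailRecip (P : Measure Ω) (X : Ω → ℝ) (s : ℝ) : ℝ≥0∞ :=
  1 / ENNReal.ofReal (1 - cdf (P.map X) s)

/-- The right-continuous generalized inverse `U^←(x) = inf {s | U(s) > x}`. -/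
def genInverse (U : ℝ → ℝ≥0∞) (x : ℝ) : ℝ :=
  sInf {s : ℝ | ENNReal.ofReal x < U s}

end FullTailDependence

end

namespace FullTailDependence

/-! Label the points of `C` by the mass `w` that `μ₀` gives to the open upper right quadrant at that
point. The corner is then `(fstLevel α G w, sndLevel α w)`. With `T = dinv t`, let `A_w` and `B_w`
be the events that the rescaled `X` and `Y` exceed these coordinates. Both marginal conditions
become the same statement: `T * P(A_w) → w` and `T * P(B_w) → w`. For `X` this is the domain of
attraction; for `Y` it is regular variation together with `dinv t * P(Y > t) → 1`
(`IsRegVar.tendsto_asymptoticInverse_mul_tail`).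

Both sides of the equivalence then say that `A_w` and `B_w` asymptotically coincide, `T * P(A_w ∩
B_w) → w`.

Vague convergence gives this by a test function squeezed between two quadrants
(`joint_of_vagueTendsto`). Conversely, the mixed regions, where exactly one coordinate exceeds, lose
all mass in the limit. A test function is therefore approximated by a step function on the shells
between successive quadrants, whose integrals converge (`tendsto_integral_of_quadrant`).

The conditional probability is tied to this statement by two facts. The generalized inverses satisfy
`x * P(Z > U^←(x)) → 1` (`tendsto_mul_tail_genInverse`). And joint tails depend asymptotically only
on the marginal masses of their levels, because half-lines are nested (`tendsto_joint_tail_congr`).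
The condition is thus the case `w = 1` along `x`, and the substitution `x = dinv t / w` recovers
every `w`. -/

lemma tendsto_of_sandwich {ι : Type*} {l : Filter ι} {f : ι → ℝ} {L : ℝ} (hL : 0 < L)
    (hlow : ∀ y, 0 < y → y < L → ∃ g : ι → ℝ, Tendsto g l (𝓝 y) ∧ ∀ᶠ i in l, g i ≤ f i)
    (hup : ∀ y, L < y → ∃ g : ι → ℝ, Tendsto g l (𝓝 y) ∧ ∀ᶠ i in l, f i ≤ g i) :
    Tendsto f l (𝓝 L) := by
  refine tendsto_order.2 ⟨fun c hc => ?_, fun c hc => ?_⟩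
  · obtain ⟨y, hy, hyL⟩ := exists_between (max_lt hc hL)
    obtain ⟨g, hg, hgf⟩ := hlow y ((le_max_right _ _).trans_lt hy) hyL
    filter_upwards [hg.eventually_const_lt ((le_max_left _ _).trans_lt hy), hgf] with i h1 h2
    exact h1.trans_le h2
  · obtain ⟨y, hyL, hy⟩ := exists_between hc
    obtain ⟨g, hg, hgf⟩ := hup y hyL
    filter_upwards [hg.eventually_lt_const hy, hgf] with i h1 h2
    exact h2.trans_lt h1

/-! ### Tail probabilities, generalized inverses, and change of levels. -/

section tails

variable {Ω : Type*} [MeasurableSpace Ω] {P : Measure Ω} [IsProbabilityMeasure P]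

lemma measureReal_tail_antitone (Z : Ω → ℝ) : Antitone fun s => P.real {ω | s < Z ω} :=
  fun _ _ h => measureReal_mono fun _ hω => lt_of_le_of_lt h hω

lemma one_sub_cdf_map {Z : Ω → ℝ} (hZ : Measurable Z) (s : ℝ) :
    1 - cdf (P.map Z) s = P.real {ω | s < Z ω} := by
  have := Measure.isProbabilityMeasure_map (μ := P) hZ.aemeasurable
  rw [cdf_eq_real, ← probReal_compl_eq_one_sub measurableSet_Iic, compl_Iic,
    map_measureReal_apply hZ measurableSet_Ioi]
  rfl

lemma ofReal_lt_tailRecip_iff {Z : Ω → ℝ} (hZ : Measurable Z) {x : ℝ} (hx : 0 < x) (s : ℝ) :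
    ENNReal.ofReal x < tailRecip P Z s ↔ x * P.real {ω | s < Z ω} < 1 := by
  rw [tailRecip, one_sub_cdf_map hZ, ENNReal.lt_div_iff_mul_lt (by simp) (by simp),
    ← ENNReal.ofReal_mul hx.le, ENNReal.ofReal_lt_one]

/-- The law of `Z` may have atoms, so the product need not equal 1 exactly. Levels of limit mass `y
< 1` eventually lie in the set defining the infimum, and levels of limit mass `y > 1` are eventually
lower bounds of it. These trap the inverse, and monotonicity of the tail transfers the trap to
masses. -/
lemma tendsto_mul_tail_genInverse {Z : Ω → ℝ} (hZ : Measurable Z)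
    (hs : ∀ c : ℝ, 0 < c →
      ∃ s : ℝ → ℝ, Tendsto (fun x => x * P.real {ω | s x < Z ω}) atTop (𝓝 c)) :
    Tendsto (fun x => x * P.real {ω | genInverse (tailRecip P Z) x < Z ω}) atTop (𝓝 1) := by
  have lower : ∀ x s s' : ℝ, 0 < x → 1 < x * P.real {ω | s < Z ω} →
      ENNReal.ofReal x < tailRecip P Z s' → s ≤ s' := by
    intro x s s' hx h1 h2
    rw [ofReal_lt_tailRecip_iff hZ hx] at h2
    by_contra! h
    have := mul_le_mul_of_nonneg_left (measureReal_tail_antitone (P := P) Z h.le) hx.le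
    simp only at this
    linarith
  -- The real `sInf` is meaningful only for a nonempty set bounded below: the level of mass 2
  -- supplies the lower bound, the level of mass 1/2 an element.
  obtain ⟨s₂, hs₂⟩ := hs 2 two_pos
  obtain ⟨s₀, hs₀⟩ := hs (1 / 2) (by norm_num)
  refine tendsto_of_sandwich one_pos (fun y hy0 hy1 => ?_) fun y hy => ?_
  · obtain ⟨s, hs⟩ := hs y hy0
    refine ⟨_, hs, ?_⟩
    filter_upwards [eventually_gt_atTop 0, hs.eventually_lt_const hy1,
      hs₂.eventually_const_lt one_lt_two] with x hx h1 h2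
    refine mul_le_mul_of_nonneg_left (measureReal_tail_antitone Z ?_) hx.le
    exact csInf_le ⟨s₂ x, fun s' hs' => lower x _ _ hx h2 hs'⟩
      ((ofReal_lt_tailRecip_iff hZ hx _).2 h1)
  · obtain ⟨s, hs⟩ := hs y (one_pos.trans hy)
    refine ⟨_, hs, ?_⟩
    filter_upwards [eventually_gt_atTop 0, hs.eventually_const_lt hy,
      hs₀.eventually_lt_const one_half_lt_one] with x hx h1 h2
    refine mul_le_mul_of_nonneg_left (measureReal_tail_antitone Z ?_) hx.le
    exact le_csInf ⟨s₀ x, (ofReal_lt_tailRecip_iff hZ hx _).2 h2⟩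
      fun s' hs' => lower x _ _ hx h1 hs'

/-- Two tail events are nested, so the mass of their symmetric difference is exactly the difference
of their masses, and intersecting with `A` can only shrink it. -/
lemma abs_measureReal_tail_inter_sub_le {Z : Ω → ℝ} (hZ : Measurable Z) (s s' : ℝ) (A : Set Ω) :
    |P.real ({ω | s < Z ω} ∩ A) - P.real ({ω | s' < Z ω} ∩ A)| ≤
      |P.real {ω | s < Z ω} - P.real {ω | s' < Z ω}| := by
  wlog h : s ≤ s' generalizing s s'
  · rw [abs_sub_comm, abs_sub_comm (P.real {ω | s < Z ω})]
    exact this s' s (le_of_not_ge h)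
  have hsub : {ω | s' < Z ω} ⊆ {ω | s < Z ω} := fun ω hω => lt_of_le_of_lt h hω
  have h1 : P.real ({ω | s' < Z ω} ∩ A) ≤ P.real ({ω | s < Z ω} ∩ A) :=
    measureReal_mono (inter_subset_inter_left _ hsub)
  have h2 : P.real ({ω | s < Z ω} ∩ A) ≤
      P.real ({ω | s' < Z ω} ∩ A) + P.real ({ω | s < Z ω} \ {ω | s' < Z ω}) := by
    refine (measureReal_mono ?_).trans (measureReal_union_le _ _)
    rintro ω ⟨hω, hA⟩
    by_cases h' : s' < Z ω
    · exact Or.inl ⟨h', hA⟩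
    · exact Or.inr ⟨hω, h'⟩
  rw [measureReal_sdiff hsub (measurableSet_lt measurable_const hZ)] at h2
  rw [abs_of_nonneg (by linarith), abs_of_nonneg (by linarith)]
  linarith

lemma tendsto_tail_inter_congr {ι : Type*} {l : Filter ι} {T s s' : ι → ℝ} {A : ι → Set Ω}
    {Z : Ω → ℝ} (hZ : Measurable Z) {L K : ℝ}
    (h : Tendsto (fun i => T i * P.real {ω | s i < Z ω}) l (𝓝 L))
    (h' : Tendsto (fun i => T i * P.real {ω | s' i < Z ω}) l (𝓝 L))
    (hA : Tendsto (fun i => T i * P.real ({ω | s i < Z ω} ∩ A i)) l (𝓝 K)) :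
    Tendsto (fun i => T i * P.real ({ω | s' i < Z ω} ∩ A i)) l (𝓝 K) := by
  have h0 : Tendsto (fun i => T i * P.real ({ω | s' i < Z ω} ∩ A i) -
      T i * P.real ({ω | s i < Z ω} ∩ A i)) l (𝓝 0) := by
    refine squeeze_zero_norm (fun i => ?_) (by simpa using (h'.sub h).abs)
    rw [Real.norm_eq_abs, ← mul_sub, ← mul_sub, abs_mul, abs_mul]
    exact mul_le_mul_of_nonneg_left (abs_measureReal_tail_inter_sub_le hZ _ _ _) (abs_nonneg _)
  simpa using h0.add hA

/-- Levels may be exchanged one coordinate at a time, since only their marginal masses matter. -/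
lemma tendsto_joint_tail_congr {ι : Type*} {l : Filter ι} {T s s' r r' : ι → ℝ}
    {X Y : Ω → ℝ} (hX : Measurable X) (hY : Measurable Y) {L K : ℝ}
    (hs : Tendsto (fun i => T i * P.real {ω | s i < X ω}) l (𝓝 L))
    (hs' : Tendsto (fun i => T i * P.real {ω | s' i < X ω}) l (𝓝 L))
    (hr : Tendsto (fun i => T i * P.real {ω | r i < Y ω}) l (𝓝 L))
    (hr' : Tendsto (fun i => T i * P.real {ω | r' i < Y ω}) l (𝓝 L))
    (h : Tendsto (fun i => T i * P.real ({ω | s i < X ω} ∩ {ω | r i < Y ω})) l (𝓝 K)) :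
    Tendsto (fun i => T i * P.real ({ω | s' i < X ω} ∩ {ω | r' i < Y ω})) l (𝓝 K) := by
  have h1 := tendsto_tail_inter_congr hX hs hs' h
  simp only [inter_comm {ω | s' _ < X ω}] at h1 ⊢
  exact tendsto_tail_inter_congr hY hr hr' h1

end tails

/-! ### Levels parametrized by limit mass. -/

/-- The level whose exceedances by the second coordinate have limit mass `w`. -/
noncomputable def sndLevel (α w : ℝ) : ℝ := w ^ (-α⁻¹)

/-- The level whose exceedances by the first coordinate have limit mass `w`. -/
noncomputable def fstLevel (α : ℝ) (G : ExtremeLaw) (w : ℝ) : ℝ := G.curveFst α (sndLevel α w)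

lemma sndLevel_pos (α : ℝ) {w : ℝ} (hw : 0 < w) : 0 < sndLevel α w := Real.rpow_pos_of_pos hw _

lemma sndLevel_one (α : ℝ) : sndLevel α 1 = 1 := Real.one_rpow _

lemma sndLevel_rpow {α : ℝ} (hα : 0 < α) {w : ℝ} (hw : 0 < w) : sndLevel α w ^ (-α) = w := by
  rw [sndLevel, ← Real.rpow_mul hw.le]
  simp [hα.ne']

lemma sndLevel_strictAntiOn {α : ℝ} (hα : 0 < α) : StrictAntiOn (sndLevel α) (Ioi 0) :=
  fun _ hx _ _ hxy => Real.rpow_lt_rpow_of_neg hx hxy (by simpa using hα)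

lemma fstLevel_gumbel {α : ℝ} (hα : 0 < α) {w : ℝ} (hw : 0 < w) :
    fstLevel α .gumbel w = -Real.log w := by
  simp only [fstLevel, ExtremeLaw.curveFst, sndLevel, Real.log_rpow hw]
  field_simp

lemma fstLevel_frechet {α : ℝ} (hα : 0 < α) {β : ℝ} (hβ : 0 < β) {w : ℝ} (hw : 0 < w) :
    fstLevel α (.frechet β hβ) w = w ^ (-β⁻¹) := by
  simp only [fstLevel, ExtremeLaw.curveFst, sndLevel]
  rw [← Real.rpow_mul hw.le]
  congr 1
  field_simp

lemma negLog_fstLevel {α : ℝ} (hα : 0 < α) (G : ExtremeLaw) {w : ℝ} (hw : 0 < w) :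
    G.negLog (fstLevel α G w) = (w : EReal) := by
  cases G with
  | gumbel =>
    rw [fstLevel_gumbel hα hw, ExtremeLaw.negLog, ExtremeLaw.distFun, neg_neg, Real.exp_log hw,
      ENNReal.log_ofReal_of_pos (Real.exp_pos _), Real.log_exp]
    simp
  | frechet β hβ =>
    rw [fstLevel_frechet hα hβ hw, ExtremeLaw.negLog, ExtremeLaw.distFun,
      if_neg (Real.rpow_pos_of_pos hw _).not_ge,
      ENNReal.log_ofReal_of_pos (Real.exp_pos _), Real.log_exp, ← Real.rpow_mul hw.le]
    simp [hβ.ne']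

/-! ### Marginal asymptotics and the conditional probability. -/

section marginals

variable {Ω : Type*} [MeasurableSpace Ω] {P : Measure Ω}
  {X Y : Ω → ℝ} {α : ℝ} {G : ExtremeLaw} {a b dinv : ℝ → ℝ} {d : ℕ → ℝ}

lemma IsInMDA.tendsto_mul_tail (hMDA : IsInMDA P X G a b) (hα : 0 < α) {w : ℝ} (hw : 0 < w) :
    Tendsto (fun t => t * P.real {ω | a t * fstLevel α G w + b t < X ω}) atTop (𝓝 w) := by
  have := hMDA.2 (fstLevel α G w)
  rwa [negLog_fstLevel hα G hw, EReal.tendsto_coe] at this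

lemma IsRegVar.tail_pos [IsProbabilityMeasure P] (hReg : IsRegVar P Y α) (t : ℝ) : 0 < P.real {ω | t < Y ω} := by
  -- For `c = 1` the ratio is 1 unless the tail vanishes, and then division by zero gives 0. The
  -- limit 1 therefore forces positive tails arbitrarily far out.
  have h := hReg 1 one_pos
  rw [Real.one_rpow] at h
  obtain ⟨s, hs, hts⟩ := ((h.eventually_const_lt one_pos).and (eventually_ge_atTop t)).exists
  refine lt_of_lt_of_le ?_ (measureReal_tail_antitone Y hts)
  refine lt_of_le_of_ne measureReal_nonneg fun h0 => ?_
  simp only [one_mul] at hs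
  simp only at h0
  rw [← h0] at hs
  simp at hs

lemma IsRegVar.tendsto_atTop_of_mul_tail [IsProbabilityMeasure P] (hReg : IsRegVar P Y α)
    (hd : Tendsto (fun n : ℕ => (n : ℝ) * P.real {ω | d n < Y ω}) atTop (𝓝 1)) :
    Tendsto d atTop atTop := by
  have h0 : Tendsto (fun n : ℕ => P.real {ω | d n < Y ω}) atTop (𝓝 0) := by
    have := hd.mul tendsto_inv_atTop_nhds_zero_nat
    rw [mul_zero] at this
    refine this.congr' ?_
    filter_upwards [eventually_gt_atTop 0] with n hn
    have : (n : ℝ) ≠ 0 := by positivity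
    field_simp
  refine tendsto_atTop.2 fun M => ?_
  filter_upwards [h0.eventually_lt_const (hReg.tail_pos M)] with n hn
  by_contra! h
  exact hn.not_ge (measureReal_tail_antitone Y h.le)

lemma IsRegVar.tendsto_mul_tail_sndLevel (hReg : IsRegVar P Y α) (hα : 0 < α)
    {ι : Type*} {l : Filter ι} {T r : ι → ℝ} (hr : Tendsto r l atTop)
    (h : Tendsto (fun i => T i * P.real {ω | r i < Y ω}) l (𝓝 1)) {w : ℝ} (hw : 0 < w) :
    Tendsto (fun i => T i * P.real {ω | sndLevel α w * r i < Y ω}) l (𝓝 w) := by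
  have h1 := h.mul ((hReg _ (sndLevel_pos α hw)).comp hr)
  rw [one_mul, sndLevel_rpow hα hw] at h1
  refine h1.congr' ?_
  filter_upwards [h.eventually_const_lt one_pos] with i hi
  have : P.real {ω | r i < Y ω} ≠ 0 := by
    rintro h0
    rw [h0] at hi
    simp at hi
  simp only [Function.comp_apply]
  field_simp

lemma tendsto_atTop_of_comp_floor (h : Tendsto (fun t => d ⌊dinv t⌋₊) atTop atTop) :
    Tendsto dinv atTop atTop := by
  refine tendsto_atTop.2 fun M => ?_
  -- While `dinv t ≤ M` only finitely many indices occur, so `d` stays bounded there without any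
  -- monotonicity.
  obtain ⟨B, hB⟩ := ((Set.finite_Iic ⌊M⌋₊).image d).bddAbove
  filter_upwards [h.eventually_gt_atTop B] with t ht
  by_contra! hM
  exact ht.not_ge (hB (mem_image_of_mem d (Nat.floor_le_floor hM.le)))

/-- With `n = ⌊dinv t⌋₊` one has `t ~ d n`, so `t` eventually lies between `c * d n` for constants
`c` on either side of 1. Regular variation evaluates the tails at those levels, and `c → 1` closes
the gap. Finally `n ~ dinv t`. -/
lemma IsRegVar.tendsto_asymptoticInverse_mul_tail [IsProbabilityMeasure P] (hReg : IsRegVar P Y α) (hα : 0 < α)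
    (hd : Tendsto (fun n : ℕ => (n : ℝ) * P.real {ω | d n < Y ω}) atTop (𝓝 1))
    (hdinv : (fun t : ℝ => d ⌊dinv t⌋₊) ~[atTop] (fun t : ℝ => t)) :
    Tendsto (fun t => dinv t * P.real {ω | t < Y ω}) atTop (𝓝 1) := by
  have hdt : Tendsto (fun t => d ⌊dinv t⌋₊) atTop atTop := hdinv.symm.tendsto_atTop tendsto_id
  have hT := tendsto_atTop_of_comp_floor hdt
  have hn : Tendsto (fun t => ⌊dinv t⌋₊) atTop atTop := tendsto_nat_floor_atTop.comp hT
  have hratio : Tendsto (fun t => t / d ⌊dinv t⌋₊) atTop (𝓝 1) :=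
    (isEquivalent_iff_tendsto_one (hdt.eventually_ne_atTop 0)).1 hdinv.symm
  have hw : ∀ w, 0 < w → Tendsto (fun t => (⌊dinv t⌋₊ : ℝ) *
      P.real {ω | sndLevel α w * d ⌊dinv t⌋₊ < Y ω}) atTop (𝓝 w) := fun w hw =>
    (hReg.tendsto_mul_tail_sndLevel hα (hReg.tendsto_atTop_of_mul_tail hd) hd hw).comp hn
  have key : Tendsto (fun t => (⌊dinv t⌋₊ : ℝ) * P.real {ω | t < Y ω}) atTop (𝓝 1) := by
    refine tendsto_of_sandwich one_pos (fun y hy0 hy1 => ⟨_, hw y hy0, ?_⟩)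
      fun y hy => ⟨_, hw y (one_pos.trans hy), ?_⟩
    · have h1 : 1 < sndLevel α y := by
        simpa [sndLevel_one] using sndLevel_strictAntiOn hα hy0 (mem_Ioi.2 one_pos) hy1
      filter_upwards [hratio.eventually_lt_const h1, hdt.eventually_gt_atTop 0] with t ht h0
      refine mul_le_mul_of_nonneg_left (measureReal_tail_antitone Y ?_) (Nat.cast_nonneg _)
      exact ((div_lt_iff₀ h0).1 ht).le
    · have h1 : sndLevel α y < 1 := by
        simpa [sndLevel_one] using
          sndLevel_strictAntiOn hα (mem_Ioi.2 one_pos) (one_pos.trans hy) hy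
      filter_upwards [hratio.eventually_const_lt h1, hdt.eventually_gt_atTop 0] with t ht h0
      refine mul_le_mul_of_nonneg_left (measureReal_tail_antitone Y ?_) (Nat.cast_nonneg _)
      exact ((lt_div_iff₀ h0).1 ht).le
  have hfl := ((tendsto_nat_floor_div_atTop (R := ℝ)).comp hT).inv₀ one_ne_zero
  have := hfl.mul key
  rw [inv_one, one_mul] at this
  refine this.congr' ?_
  filter_upwards [hn.eventually_gt_atTop 0] with t ht
  have : (⌊dinv t⌋₊ : ℝ) ≠ 0 := by positivity
  simp only [Function.comp_apply, inv_div]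
  field_simp

lemma tendsto_cond_iff_tendsto_mul {A B : ℝ → Set Ω}
    (hA : ∀ x, MeasurableSet (A x))
    (h : Tendsto (fun x => x * P.real (A x)) atTop (𝓝 1)) :
    Tendsto (fun x => ProbabilityTheory.cond P (A x) (B x)) atTop (𝓝 1) ↔
      Tendsto (fun x => x * P.real (B x ∩ A x)) atTop (𝓝 1) := by
  have h1 : Tendsto (fun x => ProbabilityTheory.cond P (A x) (B x)) atTop (𝓝 1) ↔
      Tendsto (fun x => (x * P.real (A x))⁻¹ * (x * P.real (B x ∩ A x))) atTop (𝓝 1) := by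
    rw [← ENNReal.tendsto_toReal_iff (fun x => measure_ne_top _ _) ENNReal.one_ne_top,
      ENNReal.toReal_one]
    refine tendsto_congr' ?_
    filter_upwards [eventually_gt_atTop 0] with x hx
    rw [cond_apply (hA x), ENNReal.toReal_mul, ENNReal.toReal_inv, inter_comm (B x)]
    simp only [measureReal_def]
    field_simp
  rw [h1]
  constructor
  · intro h2
    have := h.mul h2
    rw [one_mul] at this
    refine this.congr' ?_
    filter_upwards [h.eventually_const_lt one_pos] with x hx
    rw [mul_inv_cancel_left₀ hx.ne']
  · intro h2
    simpa using (h.inv₀ one_ne_zero).mul h2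

end marginals

/-! ### Approximating integrals by step functions on quadrant shells. -/

section partition

variable {E : Set (EReal × EReal)} {U V : ℝ → EReal}

/-- The upper right quadrant of `E` with corner `(U w, V w)`. -/
def quadrant (E : Set (EReal × EReal)) (U V : ℝ → EReal) (w : ℝ) : Set E :=
  {p | U w < p.1.1 ∧ V w < p.1.2}

/-- The points of `E` of which exactly one coordinate exceeds that of `(U w, V w)`. -/
def mixedRegion (E : Set (EReal × EReal)) (U V : ℝ → EReal) (w : ℝ) : Set E :=
  {p | U w < p.1.1 ∧ p.1.2 ≤ V w} ∪ {p | p.1.1 ≤ U w ∧ V w < p.1.2}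

lemma measurableSet_quadrant (w : ℝ) : MeasurableSet (quadrant E U V w) :=
  (measurableSet_lt measurable_const (measurable_fst.comp measurable_subtype_coe)).inter
    (measurableSet_lt measurable_const (measurable_snd.comp measurable_subtype_coe))

lemma measurableSet_mixedRegion (w : ℝ) : MeasurableSet (mixedRegion E U V w) :=
  ((measurableSet_lt measurable_const (measurable_fst.comp measurable_subtype_coe)).inter
    (measurableSet_le (measurable_snd.comp measurable_subtype_coe) measurable_const)).union
  ((measurableSet_le (measurable_fst.comp measurable_subtype_coe) measurable_const).inter
    (measurableSet_lt measurable_const (measurable_snd.comp measurable_subtype_coe)))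

lemma quadrant_mono (hU : Antitone U) (hV : Antitone V) : Monotone (quadrant E U V) :=
  fun _ _ h _ hp => ⟨(hU h).trans_lt hp.1, (hV h).trans_lt hp.2⟩

/-- The step function with value `c i` on the `i`-th shell between the quadrants at `w i`. -/
noncomputable def shellStep (S : ℕ → Set E) (c : ℕ → ℝ) (n : ℕ) (p : E) : ℝ :=
  ∑ i ∈ Finset.range n, (S (i + 1) \ S i).indicator (fun _ => c i) p

lemma exists_mem_shell {S : ℕ → Set E} (hS0 : S 0 = ∅) {n : ℕ} {p : E} (hp : p ∈ S n) :
    ∃ i < n, p ∈ S (i + 1) \ S i := by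
  classical
  have hex : ∃ j, p ∈ S j := ⟨n, hp⟩
  have h0 : Nat.find hex ≠ 0 := by
    intro h
    have := Nat.find_spec hex
    rw [h, hS0] at this
    exact this
  obtain ⟨i, hi⟩ := Nat.exists_eq_succ_of_ne_zero h0
  refine ⟨i, ?_, ?_, Nat.find_min hex (by omega)⟩
  · have := Nat.find_min' hex hp
    omega
  · have := Nat.find_spec hex
    rwa [hi] at this

lemma shellStep_of_mem {S : ℕ → Set E} (hS : Monotone S) (c : ℕ → ℝ) {n i : ℕ} (hi : i < n)
    {p : E} (hp : p ∈ S (i + 1) \ S i) : shellStep S c n p = c i := by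
  rw [shellStep, Finset.sum_eq_single i]
  · exact indicator_of_mem hp _
  · intro j _ hj
    refine indicator_of_notMem (fun hpj => ?_) _
    rcases lt_or_gt_of_ne hj with h | h
    · exact hp.2 (hS (Nat.succ_le_of_lt h) hpj.1)
    · exact hpj.2 (hS (Nat.succ_le_of_lt h) hp.1)
  · intro h
    exact absurd (Finset.mem_range.2 hi) h

lemma shellStep_of_notMem {S : ℕ → Set E} (hS : Monotone S) (c : ℕ → ℝ) {n : ℕ}
    {p : E} (hp : p ∉ S n) : shellStep S c n p = 0 :=
  Finset.sum_eq_zero fun _ hi => indicator_of_notMem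
    (fun h => hp (hS (Nat.succ_le_of_lt (Finset.mem_range.1 hi)) h.1)) _

lemma integrable_shellStep {S : ℕ → Set E} (hSm : ∀ i, MeasurableSet (S i)) (c : ℕ → ℝ) (n : ℕ)
    {ν : Measure E} (hν : ∀ i, ν (S i) ≠ ∞) : Integrable (shellStep S c n) ν := by
  refine integrable_finsetSum _ fun i _ => ?_
  exact (integrable_indicator_iff ((hSm _).diff (hSm i))).2
    (integrableOn_const (measure_ne_top_of_subset sdiff_subset (hν (i + 1))))

lemma integral_shellStep {S : ℕ → Set E} (hS : Monotone S) (hSm : ∀ i, MeasurableSet (S i))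
    (c : ℕ → ℝ) (n : ℕ) {ν : Measure E} (hν : ∀ i, ν (S i) ≠ ∞) :
    ∫ p, shellStep S c n p ∂ν =
      ∑ i ∈ Finset.range n, c i * (ν.real (S (i + 1)) - ν.real (S i)) := by
  simp only [shellStep]
  rw [integral_finsetSum]
  · refine Finset.sum_congr rfl fun i _ => ?_
    rw [integral_indicator_const _ ((hSm _).diff (hSm i)),
      measureReal_sdiff (hS i.le_succ) (hSm i) (hν _), smul_eq_mul, mul_comm]
  · intro i _
    exact (integrable_indicator_iff ((hSm _).diff (hSm i))).2
      (integrableOn_const (measure_ne_top_of_subset sdiff_subset (hν (i + 1))))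

/-- On `S n` off the exceptional set `R` the step function is within `ε`; on `R` only the crude
bound `2 * M` is available; elsewhere both functions vanish. The same bound makes `f` integrable
even when `ν` is infinite. -/
lemma abs_integral_sub_integral_shellStep_le {S : ℕ → Set E} (hS : Monotone S)
    (hSm : ∀ i, MeasurableSet (S i)) {c : ℕ → ℝ} {n : ℕ} {R : Set E} (hR : MeasurableSet R)
    {f : E → ℝ} (hf : Measurable f) {M ε : ℝ} (hM : ∀ p, |f p| ≤ M) (hc : ∀ i, |c i| ≤ M)
    (hS0 : S 0 = ∅) (hf0 : ∀ p, p ∉ S n → p ∉ R → f p = 0) (hε : 0 ≤ ε)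
    (hfc : ∀ i < n, ∀ p ∈ S (i + 1) \ S i, p ∉ R → |f p - c i| ≤ ε)
    {ν : Measure E} (hν : ∀ i, ν (S i) ≠ ∞) (hνR : ν R ≠ ∞) :
    |∫ p, f p ∂ν - ∫ p, shellStep S c n p ∂ν| ≤ ε * ν.real (S n) + 2 * M * ν.real R := by
  have hM0 : 0 ≤ M := (abs_nonneg _).trans (hc 0)
  have hiS : Integrable ((S n).indicator fun _ => ε) ν :=
    (integrable_indicator_iff (hSm n)).2 (integrableOn_const (hν n))
  have hiR : Integrable (R.indicator fun _ => 2 * M) ν :=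
    (integrable_indicator_iff hR).2 (integrableOn_const hνR)
  have hbound : ∀ p, |f p - shellStep S c n p| ≤
      (S n).indicator (fun _ => ε) p + R.indicator (fun _ => 2 * M) p := by
    intro p
    have h1 := hM p
    have hSn : 0 ≤ (S n).indicator (fun _ => ε) p := indicator_nonneg (fun _ _ => hε) p
    by_cases hpS : p ∈ S n
    · obtain ⟨i, hi, hpi⟩ := exists_mem_shell hS0 hpS
      rw [shellStep_of_mem hS c hi hpi]
      by_cases hpR : p ∈ R
      · rw [indicator_of_mem hpR]
        linarith [abs_sub (f p) (c i), hc i]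
      · rw [indicator_of_mem hpS, indicator_of_notMem hpR, add_zero]
        exact hfc i hi p hpi hpR
    · rw [shellStep_of_notMem hS c hpS, sub_zero]
      by_cases hpR : p ∈ R
      · rw [indicator_of_mem hpR]
        linarith
      · rw [hf0 p hpS hpR, indicator_of_notMem hpS, indicator_of_notMem hpR]
        simp
  have his := integrable_shellStep hSm c n hν
  have hid : Integrable (fun p => f p - shellStep S c n p) ν :=
    (hiS.add hiR).mono' (hf.aestronglyMeasurable.sub his.aestronglyMeasurable)
      (Eventually.of_forall hbound)
  have hif : Integrable f ν := by
    convert! hid.add his using 1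
    ext p
    simp
  rw [← integral_sub hif his]
  refine (abs_integral_le_integral_abs).trans ?_
  refine (integral_mono hid.abs (hiS.add hiR) hbound).trans ?_
  simp only [Pi.add_apply]
  rw [integral_add hiS hiR, integral_indicator_const _ (hSm n), integral_indicator_const _ hR,
    smul_eq_mul, smul_eq_mul, mul_comm, mul_comm (ν.real R)]

/-- A shell point off the mixed region has both coordinates between the two corners. By the
intermediate value theorem it is `(U r, V r')` with `r`, `r'` in one short parameter interval.
Uniform continuity on the compact square `[0, W]²` then controls `f`, including at infinite points.
-/
lemma exists_partition_approx (hU : Continuous U) (hV : Continuous V)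
    (hmem : ∀ w w', (U w, V w') ∈ E) {f : E → ℝ} (hf : Continuous f) {W ε : ℝ} (hW : 0 < W)
    (hε : 0 < ε) :
    ∃ n : ℕ, 0 < n ∧ ∀ i < n, ∀ p ∈ quadrant E U V (((i + 1 : ℕ) : ℝ) * (W / n)),
      p ∉ quadrant E U V ((i : ℝ) * (W / n)) → p ∉ mixedRegion E U V ((i : ℝ) * (W / n)) →
      |f p - f ⟨_, hmem ((i : ℝ) * (W / n)) ((i : ℝ) * (W / n))⟩| ≤ ε := by
  have hF : Continuous fun z : ℝ × ℝ => f ⟨_, hmem z.1 z.2⟩ :=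
    hf.comp (((hU.comp continuous_fst).prodMk (hV.comp continuous_snd)).subtype_mk _)
  have huc := (isCompact_Icc (a := (0 : ℝ)) (b := W)).prod (isCompact_Icc (a := (0 : ℝ)) (b := W))
    |>.uniformContinuousOn_of_continuous hF.continuousOn
  obtain ⟨δ, hδ, hFδ⟩ := Metric.uniformContinuousOn_iff.1 huc ε hε
  obtain ⟨n, hn⟩ := exists_nat_gt (W / δ)
  have hn0 : (0 : ℝ) < n := (by positivity : (0 : ℝ) < W / δ).trans hn
  have hstep : W / n < δ := by
    rw [div_lt_iff₀ hδ] at hn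
    rw [div_lt_iff₀ hn0]
    linarith
  have hstep0 : 0 < W / n := by positivity
  refine ⟨n, by exact_mod_cast hn0, fun i hi p hp hp1 hp2 => ?_⟩
  set w := (i : ℝ) * (W / n) with hw
  set w' := ((i + 1 : ℕ) : ℝ) * (W / n) with hw'
  have hww : w' = w + W / n := by rw [hw, hw']; push_cast; ring
  have hw0 : 0 ≤ w := by positivity
  have hw'W : w' ≤ W := by
    have h1 : ((i + 1 : ℕ) : ℝ) ≤ n := by exact_mod_cast hi
    calc w' ≤ n * (W / n) := mul_le_mul_of_nonneg_right h1 hstep0.le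
      _ = W := by field_simp
  have hup : p.1.1 ≤ U w ∧ p.1.2 ≤ V w := by
    by_cases h1 : U w < p.1.1
    · by_cases h2 : V w < p.1.2
      · exact absurd ⟨h1, h2⟩ hp1
      · exact absurd (Or.inl ⟨h1, not_lt.1 h2⟩) hp2
    · by_cases h2 : V w < p.1.2
      · exact absurd (Or.inr ⟨not_lt.1 h1, h2⟩) hp2
      · exact ⟨not_lt.1 h1, not_lt.1 h2⟩
  have hle : w ≤ w' := by linarith
  obtain ⟨r, hr, hrU⟩ := intermediate_value_Icc' hle hU.continuousOn ⟨hp.1.le, hup.1⟩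
  obtain ⟨r', hr', hrV⟩ := intermediate_value_Icc' hle hV.continuousOn ⟨hp.2.le, hup.2⟩
  have hpeq : p = ⟨_, hmem r r'⟩ := Subtype.ext (Prod.ext hrU.symm hrV.symm)
  have hd : ∀ q ∈ Icc w w', dist q w < δ := by
    intro q hq
    rw [Real.dist_eq, abs_of_nonneg (by linarith [hq.1])]
    linarith [hq.2]
  have hI : ∀ q ∈ Icc w w', q ∈ Icc 0 W := fun q hq => ⟨hw0.trans hq.1, hq.2.trans hw'W⟩
  have := hFδ (r, r') ⟨hI _ hr, hI _ hr'⟩ (w, w)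
    ⟨hI _ (left_mem_Icc.2 hle), hI _ (left_mem_Icc.2 hle)⟩
    (by rw [Prod.dist_eq]; exact max_lt (hd _ hr) (hd _ hr'))
  rw [Real.dist_eq] at this
  rw [hpeq]
  exact this.le

theorem tendsto_integral_of_quadrant {ι : Type*} {l : Filter ι}
    (hU : Continuous U) (hV : Continuous V) (hUa : Antitone U) (hVa : Antitone V)
    (hU0 : U 0 = ⊤) (hmem : ∀ w w', (U w, V w') ∈ E)
    {m : ι → Measure E} (hm : ∀ t, IsFiniteMeasure (m t)) {μ : Measure E}
    (hμS : ∀ w, 0 ≤ w → μ (quadrant E U V w) = ENNReal.ofReal w)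
    (hμQ : ∀ w, 0 ≤ w → μ (mixedRegion E U V w) = 0)
    (hS : ∀ w, 0 ≤ w → Tendsto (fun t => (m t).real (quadrant E U V w)) l (𝓝 w))
    (hQ : ∀ w, 0 ≤ w → Tendsto (fun t => (m t).real (mixedRegion E U V w)) l (𝓝 0))
    {f : E → ℝ} (hf : Continuous f) {M : ℝ} (hM : ∀ p, |f p| ≤ M) {W : ℝ} (hW : 0 < W)
    (hf0 : ∀ p : E, p.1.1 ≤ U W → p.1.2 ≤ V W → f p = 0) :
    Tendsto (fun t => ∫ p, f p ∂(m t)) l (𝓝 (∫ p, f p ∂μ)) := by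
  rw [Metric.tendsto_nhds]
  intro η hη
  -- The error budget is `ε * W = η / 4` for the limit measure, less than `η / 2` for `m t`, and `η
  -- / 4` between the two step integrals.
  set ε := η / (4 * W) with hεdef
  have hε : 0 < ε := by positivity
  obtain ⟨n, hn, happrox⟩ := exists_partition_approx hU hV hmem hf hW hε
  have hn0 : (0 : ℝ) < n := by exact_mod_cast hn
  set w : ℕ → ℝ := fun i => (i : ℝ) * (W / n) with hw
  have hw0 : ∀ i, 0 ≤ w i := fun i => by positivity
  have hwn : w n = W := by rw [hw]; field_simp
  set S : ℕ → Set E := fun i => quadrant E U V (w i) with hSdef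
  have hSmono : Monotone S := (quadrant_mono hUa hVa).comp
    (Nat.mono_cast.mul_const (by positivity : 0 ≤ W / n))
  have hSm : ∀ i, MeasurableSet (S i) := fun i => measurableSet_quadrant _
  have hS0 : S 0 = ∅ := by
    ext p
    simp [hSdef, hw, quadrant, hU0]
  set R : Set E := ⋃ i ∈ Finset.range (n + 1), mixedRegion E U V (w i) with hRdef
  have hR : MeasurableSet R := Finset.measurableSet_biUnion _ fun i _ => measurableSet_mixedRegion _
  have hRsub : ∀ i, i ≤ n → mixedRegion E U V (w i) ⊆ R := fun i hi =>
    subset_biUnion_of_mem (u := fun i => mixedRegion E U V (w i))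
      (Finset.mem_coe.2 (Finset.mem_range.2 (Nat.lt_succ_of_le hi)))
  set c : ℕ → ℝ := fun i => f ⟨_, hmem (w i) (w i)⟩ with hcdef
  have hfn : ∀ p, p ∉ S n → p ∉ R → f p = 0 := by
    intro p hp1 hp2
    have hp2' : p ∉ mixedRegion E U V (w n) := fun h => hp2 (hRsub n le_rfl h)
    rw [hwn] at hp2'
    simp only [hSdef, hwn] at hp1
    have h1 : ¬ U W < p.1.1 := fun h1 => by
      by_cases h2 : V W < p.1.2
      · exact hp1 ⟨h1, h2⟩
      · exact hp2' (Or.inl ⟨h1, not_lt.1 h2⟩)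
    have h2 : ¬ V W < p.1.2 := fun h2 => hp2' (Or.inr ⟨not_lt.1 h1, h2⟩)
    exact hf0 p (not_lt.1 h1) (not_lt.1 h2)
  have key : ∀ ν : Measure E, (∀ i, ν (S i) ≠ ∞) → ν R ≠ ∞ →
      |∫ p, f p ∂ν - ∑ i ∈ Finset.range n, c i * (ν.real (S (i + 1)) - ν.real (S i))| ≤
        ε * ν.real (S n) + 2 * M * ν.real R := by
    intro ν hνS hνR
    rw [← integral_shellStep hSmono hSm c n hνS]
    exact abs_integral_sub_integral_shellStep_le hSmono hSm hR hf.measurable hM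
      (fun i => hM _) hS0 hfn hε.le
      (fun i hi p hp hpR => happrox i hi p hp.1 hp.2 fun h => hpR (hRsub i hi.le h)) hνS hνR
  have hμR : μ R = 0 :=
    (measure_biUnion_null_iff (Finset.range (n + 1)).countable_toSet).2 fun i _ => hμQ _ (hw0 i)
  have hμSr : ∀ i, μ.real (S i) = w i := fun i => by
    rw [measureReal_def, hμS _ (hw0 i), ENNReal.toReal_ofReal (hw0 i)]
  have hkμ := key μ (fun i => by rw [hμS _ (hw0 i)]; exact ENNReal.ofReal_ne_top)
    (by rw [hμR]; exact ENNReal.zero_ne_top)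
  rw [hμSr n, hwn, measureReal_def, hμR, ENNReal.toReal_zero, mul_zero, add_zero] at hkμ
  have hmR : Tendsto (fun t => (m t).real R) l (𝓝 0) := by
    refine squeeze_zero (fun t => measureReal_nonneg)
      (fun t => measureReal_biUnion_finset_le _ _) ?_
    simpa using tendsto_finsetSum (Finset.range (n + 1)) fun i _ => hQ (w i) (hw0 i)
  have hbd : Tendsto (fun t => ε * (m t).real (S n) + 2 * M * (m t).real R) l (𝓝 (ε * W)) := by
    have := ((hS (w n) (hw0 n)).const_mul ε).add (hmR.const_mul (2 * M))
    simpa only [mul_zero, add_zero, hSdef, hwn] using this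
  have hsum : Tendsto (fun t => ∑ i ∈ Finset.range n,
      c i * ((m t).real (S (i + 1)) - (m t).real (S i))) l
      (𝓝 (∑ i ∈ Finset.range n, c i * (μ.real (S (i + 1)) - μ.real (S i)))) := by
    refine tendsto_finsetSum _ fun i _ => Tendsto.const_mul _ ?_
    rw [hμSr, hμSr]
    exact (hS _ (hw0 _)).sub (hS _ (hw0 _))
  have hεW : ε * W = η / 4 := by rw [hεdef]; field_simp
  filter_upwards [hbd.eventually_lt_const (by linarith : ε * W < η / 2),
    (Metric.tendsto_nhds.1 hsum) (η / 4) (by positivity)] with t h1 h2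
  have h3 := key (m t) (fun i => measure_ne_top _ _) (measure_ne_top _ _)
  rw [Real.dist_eq] at h2 ⊢
  rw [abs_lt] at h2 ⊢
  rw [abs_le] at hkμ h3
  constructor <;> linarith [h2.1, h2.2, hkμ.1, hkμ.2, h3.1, h3.2]

end partition

/-! ### Continuous coordinates and compactness in the state space. -/

section coordinates

/-- Extension of a function on `(0, ∞)` to the real line with value `∞` on `(-∞, 0]`. -/
noncomputable def topExtend (h : ℝ → ℝ) (w : ℝ) : EReal := if w ≤ 0 then ⊤ else (h w : EReal)

lemma topExtend_of_nonpos (h : ℝ → ℝ) {w : ℝ} (hw : w ≤ 0) : topExtend h w = ⊤ := if_pos hw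

lemma topExtend_of_pos (h : ℝ → ℝ) {w : ℝ} (hw : 0 < w) : topExtend h w = (h w : EReal) :=
  if_neg hw.not_ge

lemma continuous_topExtend {h : ℝ → ℝ} (hc : ContinuousOn h (Ioi 0))
    (ht : Tendsto h (𝓝[>] 0) atTop) : Continuous (topExtend h) := by
  refine continuous_iff_continuousAt.2 fun w => ?_
  rcases lt_trichotomy w 0 with hw | rfl | hw
  · refine continuousAt_const.congr (f := fun _ => (⊤ : EReal)) ?_
    filter_upwards [eventually_lt_nhds hw] with x hx
    exact (topExtend_of_nonpos h hx.le).symm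
  · rw [ContinuousAt, topExtend_of_nonpos h le_rfl, EReal.tendsto_nhds_top_iff_real]
    intro x
    filter_upwards [eventually_nhdsWithin_iff.1 (ht.eventually_gt_atTop x)] with y hy
    rcases le_or_gt y 0 with h0 | h0
    · rw [topExtend_of_nonpos h h0]
      exact EReal.coe_lt_top x
    · rw [topExtend_of_pos h h0]
      exact EReal.coe_lt_coe_iff.2 (hy h0)
  · refine ContinuousAt.congr (f := fun x => (h x : EReal)) ?_ ?_
    · exact continuous_coe_real_ereal.continuousAt.comp (hc.continuousAt (Ioi_mem_nhds hw))
    · filter_upwards [eventually_gt_nhds hw] with x hx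
      exact (topExtend_of_pos h hx).symm

lemma antitone_topExtend {h : ℝ → ℝ} (ha : AntitoneOn h (Ioi 0)) : Antitone (topExtend h) := by
  intro x y hxy
  rcases le_or_gt x 0 with hx | hx
  · rw [topExtend_of_nonpos h hx]
    exact le_top
  · rw [topExtend_of_pos h hx, topExtend_of_pos h (hx.trans_le hxy)]
    exact EReal.coe_le_coe_iff.2 (ha hx (hx.trans_le hxy) hxy)

lemma continuousOn_sndLevel (α : ℝ) : ContinuousOn (sndLevel α) (Ioi 0) :=
  continuousOn_id.rpow_const fun _ hx => Or.inl (ne_of_gt hx)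

lemma tendsto_sndLevel_nhdsGT_zero {α : ℝ} (hα : 0 < α) :
    Tendsto (sndLevel α) (𝓝[>] 0) atTop :=
  tendsto_rpow_neg_nhdsGT_zero (by simpa using hα)

lemma tendsto_sndLevel_atTop {α : ℝ} (hα : 0 < α) : Tendsto (sndLevel α) atTop (𝓝 0) :=
  tendsto_rpow_neg_atTop (by positivity)

lemma continuousOn_fstLevel {α : ℝ} (hα : 0 < α) (G : ExtremeLaw) :
    ContinuousOn (fstLevel α G) (Ioi 0) := by
  cases G with
  | gumbel =>
    refine ContinuousOn.congr (f := fun w => -Real.log w) ?_ fun w hw => fstLevel_gumbel hα hw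
    exact (Real.continuousOn_log.mono fun w hw => ne_of_gt hw).neg
  | frechet β hβ =>
    exact ContinuousOn.congr (continuousOn_sndLevel β) fun w hw => fstLevel_frechet hα hβ hw

lemma tendsto_fstLevel_nhdsGT_zero {α : ℝ} (hα : 0 < α) (G : ExtremeLaw) :
    Tendsto (fstLevel α G) (𝓝[>] 0) atTop := by
  cases G with
  | gumbel =>
    refine (tendsto_neg_atBot_atTop.comp Real.tendsto_log_nhdsGT_zero).congr' ?_
    filter_upwards [self_mem_nhdsWithin] with w hw using (fstLevel_gumbel hα hw).symm
  | frechet β hβ =>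
    refine (tendsto_sndLevel_nhdsGT_zero hβ).congr' ?_
    filter_upwards [self_mem_nhdsWithin] with w hw using (fstLevel_frechet hα hβ hw).symm

lemma curveFst_strictMonoOn {α : ℝ} (hα : 0 < α) (G : ExtremeLaw) :
    StrictMonoOn (G.curveFst α) (Ioi 0) := by
  intro x hx y hy hxy
  cases G with
  | gumbel => exact mul_lt_mul_of_pos_left (Real.log_lt_log hx hxy) hα
  | frechet β hβ => exact Real.rpow_lt_rpow (le_of_lt hx) hxy (div_pos hα hβ)

lemma fstLevel_strictAntiOn {α : ℝ} (hα : 0 < α) (G : ExtremeLaw) :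
    StrictAntiOn (fstLevel α G) (Ioi 0) := fun _ hx _ hy hxy =>
  curveFst_strictMonoOn hα G (sndLevel_pos α hy) (sndLevel_pos α hx)
    (sndLevel_strictAntiOn hα hx hy hxy)

lemma ExtremeLaw.isUpperSet_stateSpace (G : ExtremeLaw) : IsUpperSet G.stateSpace := by
  rintro ⟨x, y⟩ ⟨x', y'⟩ ⟨hx, hy⟩ h
  simp only at hx hy
  cases G with
  | gumbel =>
    refine ⟨h.1.trans hy, fun heq => h.2 ?_⟩
    simp only [Prod.mk.injEq] at heq ⊢
    exact ⟨le_bot_iff.1 (heq.1 ▸ hx), le_antisymm (heq.2 ▸ hy) h.1⟩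
  | frechet β hβ =>
    refine ⟨h.1.trans hx, h.2.1.trans hy, fun heq => h.2.2 ?_⟩
    simp only [Prod.mk.injEq] at heq ⊢
    exact ⟨le_antisymm (heq.1 ▸ hx) h.1, le_antisymm (heq.2 ▸ hy) h.2.1⟩

lemma topExtend_mem_stateSpace {α : ℝ} (hα : 0 < α) (G : ExtremeLaw) (w w' : ℝ) :
    (topExtend (fstLevel α G) w, topExtend (sndLevel α) w') ∈ G.stateSpace := by
  -- The curve point of this larger mass lies below the given point, and the state space is an upper
  -- set. The 1 guarantees a positive mass.
  have hW : 0 < max (max w w') 1 := lt_max_of_lt_right one_pos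
  have h := G.curve_subset_stateSpace α
    ((G.mem_curve_iff α _).2 ⟨_, sndLevel_pos α hW, rfl⟩)
  refine G.isUpperSet_stateSpace (Prod.mk_le_mk.2 ⟨?_, ?_⟩) h
  · refine le_trans (topExtend_of_pos (fstLevel α G) hW).symm.le ?_
    exact antitone_topExtend (fstLevel_strictAntiOn hα G).antitoneOn
      ((le_max_left _ _).trans (le_max_left _ _))
  · refine le_trans (topExtend_of_pos (sndLevel α) hW).symm.le ?_
    exact antitone_topExtend (sndLevel_strictAntiOn hα).antitoneOn
      ((le_max_right _ _).trans (le_max_left _ _))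

lemma exists_fstLevel_lt_or_sndLevel_lt {α : ℝ} (hα : 0 < α) (G : ExtremeLaw)
    (p : G.stateSpace) :
    ∃ n : ℕ, topExtend (fstLevel α G) (n + 1) < p.1.1 ∨
      topExtend (sndLevel α) (n + 1) < p.1.2 := by
  have htop : Tendsto (fun n : ℕ => (n : ℝ) + 1) atTop atTop :=
    tendsto_natCast_atTop_atTop.atTop_add tendsto_const_nhds
  have hn : ∀ n : ℕ, (0 : ℝ) < n + 1 := fun n => by positivity
  have hzero : ∀ {x : EReal} {γ : ℝ}, 0 < γ → 0 < x →
      ∃ n : ℕ, ((sndLevel γ (n + 1) : ℝ) : EReal) < x := by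
    intro x γ hγ hx
    exact (((continuous_coe_real_ereal.tendsto 0).comp
      ((tendsto_sndLevel_atTop hγ).comp htop)).eventually_lt_const hx).exists
  obtain ⟨⟨x, y⟩, hp⟩ := p
  simp only
  cases G with
  | gumbel =>
    rcases hp.1.lt_or_eq with hy | hy
    · obtain ⟨n, hn'⟩ := hzero hα hy
      exact ⟨n, Or.inr (by rwa [topExtend_of_pos _ (hn n)])⟩
    · have hx : ⊥ < x := bot_lt_iff_ne_bot.2 fun h => hp.2 (Prod.ext h hy.symm)
      obtain ⟨z, hz⟩ := EReal.lt_iff_exists_real_btwn.1 hx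
      have hlog : Tendsto (fun n : ℕ => -Real.log (n + 1)) atTop atBot :=
        tendsto_neg_atTop_atBot.comp (Real.tendsto_log_atTop.comp htop)
      obtain ⟨n, hn'⟩ := (hlog.eventually_lt_atBot z).exists
      refine ⟨n, Or.inl ?_⟩
      rw [topExtend_of_pos _ (hn n), fstLevel_gumbel hα (hn n)]
      exact (EReal.coe_lt_coe_iff.2 hn').trans hz.2
  | frechet β hβ =>
    rcases hp.2.1.lt_or_eq with hy | hy
    · obtain ⟨n, hn'⟩ := hzero hα hy
      exact ⟨n, Or.inr (by rwa [topExtend_of_pos _ (hn n)])⟩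
    · have hx : 0 < x := lt_of_le_of_ne hp.1 fun h => hp.2.2 (Prod.ext h.symm hy.symm)
      obtain ⟨n, hn'⟩ := hzero hβ hx
      refine ⟨n, Or.inl ?_⟩
      rw [topExtend_of_pos _ (hn n), fstLevel_frechet hα hβ (hn n)]
      exact hn'

/-- As `w → ∞` the corners approach the deleted point, so the complements of the lower left
rectangles form an increasing open cover of the state space. -/
lemma exists_eq_zero_of_hasCompactSupport {α : ℝ} (hα : 0 < α) (G : ExtremeLaw)
    {f : G.stateSpace → ℝ} (hf : HasCompactSupport f) :
    ∃ W : ℝ, 0 < W ∧ ∀ p : G.stateSpace, p.1.1 ≤ topExtend (fstLevel α G) W →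
      p.1.2 ≤ topExtend (sndLevel α) W → f p = 0 := by
  obtain ⟨n, hn⟩ := IsCompact.elim_directed_cover hf.isCompact
    (fun n : ℕ => {p : G.stateSpace | topExtend (fstLevel α G) (n + 1) < p.1.1} ∪
      {p : G.stateSpace | topExtend (sndLevel α) (n + 1) < p.1.2})
    (fun n => (isOpen_lt continuous_const (continuous_fst.comp continuous_subtype_val)).union
      (isOpen_lt continuous_const (continuous_snd.comp continuous_subtype_val)))
    (fun p _ => mem_iUnion.2 (exists_fstLevel_lt_or_sndLevel_lt hα G p))
    (Monotone.directed_le fun n k hnk => by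
      have h : (n : ℝ) + 1 ≤ k + 1 := by exact_mod_cast Nat.succ_le_succ hnk
      exact union_subset_union
        (fun p hp => (antitone_topExtend (fstLevel_strictAntiOn hα G).antitoneOn h).trans_lt hp)
        (fun p hp => (antitone_topExtend (sndLevel_strictAntiOn hα).antitoneOn h).trans_lt hp))
  refine ⟨n + 1, by positivity, fun p h1 h2 => ?_⟩
  by_contra h
  rcases hn (subset_tsupport f h) with h' | h'
  · exact h1.not_gt h'
  · exact h2.not_gt h'

/-- Keeping the second coordinate away from 0 avoids the deleted point, so the set is already closed
in the compact product `EReal × EReal`. -/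
lemma isCompact_le_snd (G : ExtremeLaw) {v : ℝ} (hv : 0 < v) :
    IsCompact {p : G.stateSpace | (v : EReal) ≤ p.1.2} := by
  have h0 : (0 : EReal) < v := EReal.coe_pos.2 hv
  have hcl : IsClosed {p : EReal × EReal | (v : EReal) ≤ p.2} :=
    isClosed_le continuous_const continuous_snd
  rw [Subtype.isCompact_iff]
  cases G with
  | gumbel =>
    convert hcl.isCompact using 1
    ext p
    constructor
    · rintro ⟨q, hq, rfl⟩
      exact hq
    · intro hp
      have hp2 : 0 < p.2 := h0.trans_le hp
      exact ⟨⟨p, hp2.le, fun h => hp2.ne' (congrArg Prod.snd h)⟩, hp, rfl⟩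
  | frechet β hβ =>
    convert ((isClosed_le continuous_const continuous_fst :
      IsClosed {p : EReal × EReal | 0 ≤ p.1}).inter hcl).isCompact using 1
    ext p
    constructor
    · rintro ⟨q, hq, rfl⟩
      exact ⟨q.2.1, hq⟩
    · rintro ⟨hp1, hp⟩
      have hp2 : 0 < p.2 := h0.trans_le hp
      exact ⟨⟨p, hp1, hp2.le, fun h => hp2.ne' (congrArg Prod.snd h)⟩, hp, rfl⟩

end coordinates

/-! ### Masses of quadrants and mixed regions under the limit measure. -/

section exponent

variable {α : ℝ} (G : ExtremeLaw)

lemma ae_exponentMeasure_mem_curve : ∀ᵐ p ∂(exponentMeasure α G), p.1 ∈ G.curve α :=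
  exponentMeasure_curve_compl α G

lemma fstLevel_lt_curveFst_iff (hα : 0 < α) {v w : ℝ} (hv : 0 < v) (hw : 0 < w) :
    fstLevel α G w < G.curveFst α v ↔ sndLevel α w < v :=
  (curveFst_strictMonoOn hα G).lt_iff_lt (sndLevel_pos α hw) hv

/-- On `C` the first coordinate is a strictly increasing function of the second, so exceeding the
corner in one coordinate means exceeding it in both. -/
lemma exponentMeasure_quadrant (hα : 0 < α) {w : ℝ} (hw : 0 ≤ w) :
    exponentMeasure α G
      (quadrant G.stateSpace (topExtend (fstLevel α G)) (topExtend (sndLevel α)) w) =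
      ENNReal.ofReal w := by
  rcases hw.eq_or_lt with rfl | hw
  · simp [quadrant, topExtend_of_nonpos _ le_rfl]
  · rw [← sndLevel_rpow hα hw, ← exponentMeasure_curve_Ioi hα G (sndLevel_pos α hw),
      sndLevel_rpow hα hw]
    refine measure_congr (eventuallyEq_set.2 ?_)
    filter_upwards [ae_exponentMeasure_mem_curve G] with p hp
    obtain ⟨v, hv, hpv⟩ := (G.mem_curve_iff α _).1 hp
    rw [and_iff_right hp]
    simp only [quadrant, mem_ofPred_eq, topExtend_of_pos _ hw, hpv,
      ExtremeLaw.curvePoint, EReal.coe_lt_coe_iff]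
    exact ⟨fun h => h.2, fun h => ⟨(fstLevel_lt_curveFst_iff G hα hv hw).2 h, h⟩⟩

lemma exponentMeasure_mixedRegion (hα : 0 < α) {w : ℝ} (hw : 0 ≤ w) :
    exponentMeasure α G
      (mixedRegion G.stateSpace (topExtend (fstLevel α G)) (topExtend (sndLevel α)) w) = 0 := by
  rcases hw.eq_or_lt with rfl | hw
  · simp [mixedRegion, topExtend_of_nonpos _ le_rfl]
  · rw [measure_eq_zero_iff_ae_notMem]
    filter_upwards [ae_exponentMeasure_mem_curve G] with p hp
    obtain ⟨v, hv, hpv⟩ := (G.mem_curve_iff α _).1 hp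
    have := fstLevel_lt_curveFst_iff G hα hv hw
    simp only [mixedRegion, topExtend_of_pos _ hw, hpv, ExtremeLaw.curvePoint, mem_union,
      mem_ofPred_eq, EReal.coe_lt_coe_iff, EReal.coe_le_coe_iff]
    rintro (⟨h1, h2⟩ | ⟨h1, h2⟩)
    · exact h2.not_gt (this.1 h1)
    · exact h1.not_gt (this.2 h2)

end exponent

/-! ### Rescaled laws in terms of exceedance events. -/

section exceedances

variable {Ω : Type*} {X Y : Ω → ℝ} {α : ℝ} {G : ExtremeLaw} {a b : ℝ → ℝ}

/-- The event that `X` exceeds the normalized level of limit mass `w` at time `s`. -/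
def fstExceeds (X : Ω → ℝ) (α : ℝ) (G : ExtremeLaw) (a b : ℝ → ℝ) (s w : ℝ) : Set Ω :=
  {ω | a s * fstLevel α G w + b s < X ω}

/-- The event that `Y` exceeds the normalized level of limit mass `w` at time `t`. -/
def sndExceeds (Y : Ω → ℝ) (α t w : ℝ) : Set Ω :=
  {ω | sndLevel α w * t < Y ω}

lemma fstLevel_lt_div_iff {s w : ℝ} (hs : 0 < a s) (ω : Ω) :
    fstLevel α G w < (X ω - b s) / a s ↔ ω ∈ fstExceeds X α G a b s w := by
  rw [lt_div_iff₀ hs, fstExceeds, mem_ofPred_eq, lt_sub_iff_add_lt, mul_comm]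

lemma sndLevel_lt_div_iff {t w : ℝ} (ht : 0 < t) (ω : Ω) :
    sndLevel α w < Y ω / t ↔ ω ∈ sndExceeds Y α t w := by
  rw [lt_div_iff₀ ht, sndExceeds, mem_ofPred_eq]

end exceedances

section rescaled

variable {Ω : Type*} [MeasurableSpace Ω] {P : Measure Ω}
  {X Y : Ω → ℝ} {α : ℝ} {G : ExtremeLaw} {a b dinv : ℝ → ℝ}

lemma measurableSet_fstExceeds (hX : Measurable X) (s w : ℝ) :
    MeasurableSet (fstExceeds X α G a b s w) :=
  measurableSet_lt measurable_const hX

lemma measurableSet_sndExceeds (hY : Measurable Y) (t w : ℝ) :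
    MeasurableSet (sndExceeds Y α t w) :=
  measurableSet_lt measurable_const hY

lemma rescaledLaw_apply (hX : Measurable X) (hY : Measurable Y) (t : ℝ) {S : Set G.stateSpace}
    (hS : MeasurableSet S) :
    rescaledLaw P X Y G a b dinv t S =
      P {ω | ((((X ω - b (dinv t)) / a (dinv t) : ℝ) : EReal), ((Y ω / t : ℝ) : EReal)) ∈
        Subtype.val '' S} := by
  rw [rescaledLaw, comap_subtype_coe_apply G.measurableSet_stateSpace,
    Measure.map_apply _ (G.measurableSet_stateSpace.subtype_image hS)]
  · rfl
  · exact (((hX.sub_const _).div_const _).coe_real_ereal).prodMk (hY.div_const _).coe_real_ereal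

lemma rescaledLaw_quadrant (hα : 0 < α) (hX : Measurable X) (hY : Measurable Y) {t w : ℝ}
    (ht : 0 < t) (ha : 0 < a (dinv t)) (hw : 0 < w) :
    rescaledLaw P X Y G a b dinv t
      (quadrant G.stateSpace (topExtend (fstLevel α G)) (topExtend (sndLevel α)) w) =
      P (fstExceeds X α G a b (dinv t) w ∩ sndExceeds Y α t w) := by
  rw [rescaledLaw_apply hX hY t (measurableSet_quadrant w)]
  congr 1
  ext ω
  rw [mem_inter_iff, ← fstLevel_lt_div_iff ha, ← sndLevel_lt_div_iff ht, mem_ofPred_eq]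
  constructor
  · rintro ⟨p, hp, hpω⟩
    simpa only [quadrant, mem_ofPred_eq, hpω, topExtend_of_pos _ hw, EReal.coe_lt_coe_iff] using hp
  · intro h
    have h' : topExtend (fstLevel α G) w < (((X ω - b (dinv t)) / a (dinv t) : ℝ) : EReal) ∧
        topExtend (sndLevel α) w < ((Y ω / t : ℝ) : EReal) := by
      simpa only [topExtend_of_pos _ hw, EReal.coe_lt_coe_iff] using h
    exact ⟨⟨_, G.isUpperSet_stateSpace (Prod.mk_le_mk.2 ⟨h'.1.le, h'.2.le⟩)
      (topExtend_mem_stateSpace hα G w w)⟩, h', rfl⟩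

/-- Only an inequality is claimed: the restriction to the state space may discard outcomes with one
exceedance whose other coordinate is negative. -/
lemma rescaledLaw_mixedRegion_le (hX : Measurable X) (hY : Measurable Y) {t w : ℝ}
    (ht : 0 < t) (ha : 0 < a (dinv t)) (hw : 0 < w) :
    rescaledLaw P X Y G a b dinv t
      (mixedRegion G.stateSpace (topExtend (fstLevel α G)) (topExtend (sndLevel α)) w) ≤
      P ((fstExceeds X α G a b (dinv t) w \ sndExceeds Y α t w) ∪
        (sndExceeds Y α t w \ fstExceeds X α G a b (dinv t) w)) := by
  rw [rescaledLaw_apply hX hY t (measurableSet_mixedRegion w)]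
  refine measure_mono ?_
  rintro ω ⟨p, hp, hpω⟩
  rw [mem_union, Set.mem_sdiff, Set.mem_sdiff, ← fstLevel_lt_div_iff ha, ← sndLevel_lt_div_iff ht]
  simpa only [mixedRegion, mem_union, mem_ofPred_eq, hpω, topExtend_of_pos _ hw,
    EReal.coe_lt_coe_iff, EReal.coe_le_coe_iff, not_lt, and_comm] using hp

end rescaled

/-! ### Vague convergence versus joint exceedance masses. -/

section vague

variable {Ω : Type*} [MeasurableSpace Ω] {P : Measure Ω}
  {X Y : Ω → ℝ} {α : ℝ} {G : ExtremeLaw} {a b dinv : ℝ → ℝ}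

lemma tendsto_rescaledLaw_quadrant_iff (hα : 0 < α) (hX : Measurable X) (hY : Measurable Y)
    (ha : ∀ᶠ t in atTop, 0 < a (dinv t)) (hT : ∀ᶠ t in atTop, 0 < dinv t)
    {w L : ℝ} (hw : 0 < w) :
    Tendsto (fun t => (ENNReal.ofReal (dinv t) • rescaledLaw P X Y G a b dinv t).real
      (quadrant G.stateSpace (topExtend (fstLevel α G)) (topExtend (sndLevel α)) w)) atTop (𝓝 L) ↔
    Tendsto (fun t => dinv t * P.real (fstExceeds X α G a b (dinv t) w ∩ sndExceeds Y α t w))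
      atTop (𝓝 L) := by
  refine tendsto_congr' ?_
  filter_upwards [ha, hT, eventually_gt_atTop 0] with t h1 h2 h3
  rw [measureReal_ennreal_smul_apply, ENNReal.toReal_ofReal h2.le, measureReal_def,
    rescaledLaw_quadrant hα hX hY h3 h1 hw, measureReal_def]

lemma tendsto_rescaledLaw_mixedRegion [IsProbabilityMeasure P] (hX : Measurable X) (hY : Measurable Y)
    (ha : ∀ᶠ t in atTop, 0 < a (dinv t)) (hT : ∀ᶠ t in atTop, 0 < dinv t)
    {w : ℝ} (hw : 0 < w)
    (hA : Tendsto (fun t => dinv t * P.real (fstExceeds X α G a b (dinv t) w)) atTop (𝓝 w))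
    (hB : Tendsto (fun t => dinv t * P.real (sndExceeds Y α t w)) atTop (𝓝 w))
    (hAB : Tendsto (fun t => dinv t *
      P.real (fstExceeds X α G a b (dinv t) w ∩ sndExceeds Y α t w)) atTop (𝓝 w)) :
    Tendsto (fun t => (ENNReal.ofReal (dinv t) • rescaledLaw P X Y G a b dinv t).real
      (mixedRegion G.stateSpace (topExtend (fstLevel α G)) (topExtend (sndLevel α)) w))
      atTop (𝓝 0) := by
  -- The symmetric difference of the two events has mass `(P(A) - P(A ∩ B)) + (P(B) - P(A ∩ B))`.
  have h := (hA.sub hAB).add (hB.sub hAB)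
  rw [sub_self, add_zero] at h
  refine squeeze_zero' (Eventually.of_forall fun t => measureReal_nonneg) ?_ h
  filter_upwards [ha, hT, eventually_gt_atTop 0] with t h1 h2 h3
  rw [measureReal_ennreal_smul_apply, ENNReal.toReal_ofReal h2.le, ← mul_sub, ← mul_sub, ← mul_add]
  refine mul_le_mul_of_nonneg_left ?_ h2.le
  refine (ENNReal.toReal_mono (measure_ne_top _ _)
    (rescaledLaw_mixedRegion_le hX hY h3 h1 hw)).trans ?_
  refine (measureReal_union_le _ _).trans (add_le_add ?_ ?_)
  · have := measureReal_inter_add_sdiff (μ := P) (s := fstExceeds X α G a b (dinv t) w)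
      (measurableSet_sndExceeds (α := α) hY t w)
    linarith
  · have := measureReal_inter_add_sdiff (μ := P) (s := sndExceeds Y α t w)
      (measurableSet_fstExceeds (α := α) (G := G) (a := a) (b := b) hX (dinv t) w)
    rw [inter_comm] at this
    linarith

lemma vagueTendsto_of_joint [IsProbabilityMeasure P] (hα : 0 < α) (hX : Measurable X) (hY : Measurable Y)
    (ha : ∀ᶠ t in atTop, 0 < a (dinv t)) (hT : ∀ᶠ t in atTop, 0 < dinv t)
    (hA : ∀ w, 0 < w →
      Tendsto (fun t => dinv t * P.real (fstExceeds X α G a b (dinv t) w)) atTop (𝓝 w))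
    (hB : ∀ w, 0 < w → Tendsto (fun t => dinv t * P.real (sndExceeds Y α t w)) atTop (𝓝 w))
    (hAB : ∀ w, 0 < w → Tendsto (fun t => dinv t *
      P.real (fstExceeds X α G a b (dinv t) w ∩ sndExceeds Y α t w)) atTop (𝓝 w)) :
    VagueTendsto (fun t : ℝ => ENNReal.ofReal (dinv t) • rescaledLaw P X Y G a b dinv t)
      (exponentMeasure α G) := by
  intro f
  obtain ⟨W, hW, hfW⟩ := exists_eq_zero_of_hasCompactSupport hα G f.hasCompactSupport
  obtain ⟨M, hM⟩ := f.continuous.bounded_above_of_compact_support f.hasCompactSupport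
  refine tendsto_integral_of_quadrant
    (continuous_topExtend (continuousOn_fstLevel hα G) (tendsto_fstLevel_nhdsGT_zero hα G))
    (continuous_topExtend (continuousOn_sndLevel α) (tendsto_sndLevel_nhdsGT_zero hα))
    (antitone_topExtend (fstLevel_strictAntiOn hα G).antitoneOn)
    (antitone_topExtend (sndLevel_strictAntiOn hα).antitoneOn)
    (topExtend_of_nonpos _ le_rfl) (topExtend_mem_stateSpace hα G) (fun t => ?_)
    (fun w hw => exponentMeasure_quadrant G hα hw)
    (fun w hw => exponentMeasure_mixedRegion G hα hw)
    (fun w hw => ?_) (fun w hw => ?_) f.continuous hM hW hfW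
  · have : IsFiniteMeasure (rescaledLaw P X Y G a b dinv t) := by
      rw [rescaledLaw]
      infer_instance
    exact Measure.smul_finite _ ENNReal.ofReal_ne_top
  · rcases hw.eq_or_lt with rfl | hw
    · simp [quadrant, topExtend_of_nonpos _ le_rfl]
    · exact (tendsto_rescaledLaw_quadrant_iff hα hX hY ha hT hw).2 (hAB w hw)
  · rcases hw.eq_or_lt with rfl | hw
    · simp [mixedRegion, topExtend_of_nonpos _ le_rfl]
    · exact tendsto_rescaledLaw_mixedRegion hX hY ha hT hw (hA w hw) (hB w hw) (hAB w hw)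

/-- A product of Urysohn functions of the coordinates; the factor in the second coordinate alone
already forces compact support. -/
lemma exists_compactlySupported_between_quadrants (hα : 0 < α) (G : ExtremeLaw) {w w' : ℝ}
    (hw' : 0 < w') (hw : w' < w) :
    ∃ f : C_c(G.stateSpace, ℝ),
      (∀ p, (quadrant G.stateSpace (topExtend (fstLevel α G)) (topExtend (sndLevel α)) w').indicator
        (fun _ => (1 : ℝ)) p ≤ f p) ∧
      ∀ p, f p ≤ (quadrant G.stateSpace (topExtend (fstLevel α G)) (topExtend (sndLevel α))
        w).indicator (fun _ => (1 : ℝ)) p := by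
  have hw0 := hw'.trans hw
  have hurysohn : ∀ {x y : ℝ}, x < y → ∃ φ : C(EReal, ℝ), EqOn φ 0 (Iic (x : EReal)) ∧
      EqOn φ 1 (Ici (y : EReal)) ∧ ∀ z, φ z ∈ Icc (0 : ℝ) 1 := fun h =>
    exists_continuous_zero_one_of_isClosed isClosed_Iic isClosed_Ici
      (Iic_disjoint_Ici.2 (EReal.coe_lt_coe_iff.2 h).not_ge)
  obtain ⟨χ, hχ0, hχ1, hχ⟩ := hurysohn (fstLevel_strictAntiOn hα G hw' hw0 hw)
  obtain ⟨φ, hφ0, hφ1, hφ⟩ := hurysohn (sndLevel_strictAntiOn hα hw' hw0 hw)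
  refine ⟨⟨⟨fun p => χ p.1.1 * φ p.1.2, ?_⟩, ?_⟩, fun p => ?_, fun p => ?_⟩
  · exact (χ.continuous.comp (continuous_fst.comp continuous_subtype_val)).mul
      (φ.continuous.comp (continuous_snd.comp continuous_subtype_val))
  · refine HasCompactSupport.intro (isCompact_le_snd G (sndLevel_pos α hw0)) fun p hp => ?_
    have hp' : p.1.2 ∈ Iic (sndLevel α w : EReal) := mem_Iic.2 (le_of_not_ge hp)
    simp [hφ0 hp']
  · change _ ≤ χ p.1.1 * φ p.1.2
    refine indicator_apply_le' (fun hp => ?_) fun _ => mul_nonneg (hχ _).1 (hφ _).1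
    simp only [quadrant, topExtend_of_pos _ hw', mem_ofPred_eq] at hp
    rw [hχ1 hp.1.le, hφ1 hp.2.le]
    simp
  · change χ p.1.1 * φ p.1.2 ≤ _
    by_cases hp : p ∈ quadrant G.stateSpace (topExtend (fstLevel α G)) (topExtend (sndLevel α)) w
    · rw [indicator_of_mem hp]
      exact mul_le_one₀ (hχ _).2 (hφ _).1 (hφ _).2
    · rw [indicator_of_notMem hp]
      simp only [quadrant, topExtend_of_pos _ hw0, mem_ofPred_eq, not_and_or, not_lt] at hp
      rcases hp with h | h
      · simp [hχ0 h]
      · simp [hφ0 h]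

/-- Test functions are needed only for the lower bound. The upper bound is the marginal mass of the
exceedance by `Y`. -/
lemma joint_of_vagueTendsto [IsProbabilityMeasure P] (hα : 0 < α) (hX : Measurable X) (hY : Measurable Y)
    (ha : ∀ᶠ t in atTop, 0 < a (dinv t)) (hT : ∀ᶠ t in atTop, 0 < dinv t)
    (hV : VagueTendsto (fun t : ℝ => ENNReal.ofReal (dinv t) • rescaledLaw P X Y G a b dinv t)
      (exponentMeasure α G)) {w : ℝ} (hw : 0 < w)
    (hB : Tendsto (fun t => dinv t * P.real (sndExceeds Y α t w)) atTop (𝓝 w)) :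
    Tendsto (fun t => dinv t *
      P.real (fstExceeds X α G a b (dinv t) w ∩ sndExceeds Y α t w)) atTop (𝓝 w) := by
  rw [← tendsto_rescaledLaw_quadrant_iff hα hX hY ha hT hw]
  set Q := quadrant G.stateSpace (topExtend (fstLevel α G)) (topExtend (sndLevel α)) with hQdef
  have hQm : ∀ v, MeasurableSet (Q v) := fun v => measurableSet_quadrant v
  have hint : ∀ {ν : Measure G.stateSpace} {v : ℝ}, ν (Q v) ≠ ∞ →
      Integrable ((Q v).indicator fun _ => (1 : ℝ)) ν := fun h =>
    (integrable_indicator_iff (hQm _)).2 (integrableOn_const h)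
  have hintf : ∀ {ν : Measure G.stateSpace} (f : C_c(G.stateSpace, ℝ)) {v v' : ℝ}, ν (Q v) ≠ ∞ →
      (∀ p, (Q v').indicator (fun _ => (1 : ℝ)) p ≤ f p) →
      (∀ p, f p ≤ (Q v).indicator (fun _ => (1 : ℝ)) p) → Integrable f ν := by
    intro ν f v v' h h1 h2
    refine (hint h).mono' f.continuous.aestronglyMeasurable (Eventually.of_forall fun p => ?_)
    rw [Real.norm_eq_abs, abs_of_nonneg ((indicator_nonneg (fun _ _ => zero_le_one) p).trans (h1 p))]
    exact h2 p
  have hmfin : ∀ t, IsFiniteMeasure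
      (ENNReal.ofReal (dinv t) • rescaledLaw P X Y G a b dinv t) := by
    intro t
    have : IsFiniteMeasure (rescaledLaw P X Y G a b dinv t) := by
      rw [rescaledLaw]
      infer_instance
    exact Measure.smul_finite _ ENNReal.ofReal_ne_top
  refine tendsto_of_sandwich hw (fun y hy hyw => ?_) fun y hy => ?_
  · obtain ⟨f, hf1, hf2⟩ := exists_compactlySupported_between_quadrants hα G hy hyw
    have hμ : ∀ v, 0 < v → exponentMeasure α G (Q v) ≠ ∞ := fun v hv => by
      rw [hQdef, exponentMeasure_quadrant G hα hv.le]
      exact ENNReal.ofReal_ne_top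
    have hlow : y ≤ ∫ p, f p ∂(exponentMeasure α G) := by
      refine le_trans (le_of_eq ?_) (integral_mono (hint (hμ y hy)) (hintf f (hμ w hw) hf1 hf2) hf1)
      rw [integral_indicator_const _ (hQm y), measureReal_def, hQdef,
        exponentMeasure_quadrant G hα hy.le, ENNReal.toReal_ofReal hy.le, smul_eq_mul, mul_one]
    -- The sandwich requires a minorant with limit exactly `y`, so the nonnegative excess of the
    -- limit integral over `y` is subtracted.
    refine ⟨_, by simpa only [sub_sub_cancel] using
      (hV f).sub_const (∫ p, f p ∂(exponentMeasure α G) - y), Eventually.of_forall fun t => ?_⟩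
    refine (sub_le_self _ (sub_nonneg.2 hlow)).trans ?_
    refine (integral_mono (hintf f (measure_ne_top _ _) hf1 hf2)
      (hint (measure_ne_top _ _)) hf2).trans (le_of_eq ?_)
    rw [integral_indicator_const _ (hQm w), smul_eq_mul, mul_one]
  · refine ⟨_, by simpa only [add_sub_cancel] using hB.add_const (y - w), ?_⟩
    filter_upwards [ha, hT, eventually_gt_atTop 0] with t h1 h2 h3
    rw [measureReal_ennreal_smul_apply, ENNReal.toReal_ofReal h2.le, measureReal_def,
      rescaledLaw_quadrant hα hX hY h3 h1 hw]
    have : dinv t * P.real (fstExceeds X α G a b (dinv t) w ∩ sndExceeds Y α t w) ≤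
        dinv t * P.real (sndExceeds Y α t w) :=
      mul_le_mul_of_nonneg_left (measureReal_mono inter_subset_right) h2.le
    rw [measureReal_def] at this
    linarith

end vague

theorem vagueTendsto_iff_tendsto_cond {Ω : Type*} [MeasurableSpace Ω] {P : Measure Ω}
    [IsProbabilityMeasure P] {X Y : Ω → ℝ} (hX : Measurable X) (hY : Measurable Y)
    {α : ℝ} (hα0 : 0 < α) {G : ExtremeLaw} {a b : ℝ → ℝ} (hMDA : IsInMDA P X G a b)
    (hReg : IsRegVar P Y α) {d : ℕ → ℝ}
    (hd : Tendsto (fun n : ℕ => (n : ℝ) * (1 - cdf (P.map Y) (d n))) atTop (𝓝 1))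
    {dinv : ℝ → ℝ}
    (hdinv₁ : (fun t : ℝ => d ⌊dinv t⌋₊) ~[atTop] (fun t : ℝ => t))
    (hdinv₂ : (fun t : ℝ => dinv (d ⌊t⌋₊)) ~[atTop] (fun t : ℝ => t)) :
    VagueTendsto (fun t : ℝ => ENNReal.ofReal (dinv t) • rescaledLaw P X Y G a b dinv t)
        (exponentMeasure α G) ↔
      Tendsto
        (fun x : ℝ => ProbabilityTheory.cond P {ω | genInverse (tailRecip P Y) x < Y ω}
          {ω | genInverse (tailRecip P X) x < X ω})
        atTop (𝓝 1) := by
  simp only [one_sub_cdf_map hY] at hd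
  have hdt : Tendsto (fun t => d ⌊dinv t⌋₊) atTop atTop := hdinv₁.symm.tendsto_atTop tendsto_id
  have hT : Tendsto dinv atTop atTop := tendsto_atTop_of_comp_floor hdt
  have hT0 : ∀ᶠ t in atTop, 0 < dinv t := hT.eventually_gt_atTop 0
  have ha : ∀ᶠ t in atTop, 0 < a (dinv t) := hT.eventually hMDA.1
  have hMX : ∀ w, 0 < w → Tendsto (fun s => s * P.real (fstExceeds X α G a b s w)) atTop (𝓝 w) :=
    fun w hw => hMDA.tendsto_mul_tail hα0 hw
  have hA : ∀ w, 0 < w →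
      Tendsto (fun t => dinv t * P.real (fstExceeds X α G a b (dinv t) w)) atTop (𝓝 w) :=
    fun w hw => (hMX w hw).comp hT
  have hB : ∀ w, 0 < w → Tendsto (fun t => dinv t * P.real (sndExceeds Y α t w)) atTop (𝓝 w) :=
    fun w hw => hReg.tendsto_mul_tail_sndLevel hα0 tendsto_id
      (hReg.tendsto_asymptoticInverse_mul_tail hα0 hd hdinv₁) hw
  have hdinf : Tendsto (fun x : ℝ => d ⌊x⌋₊) atTop atTop :=
    (hReg.tendsto_atTop_of_mul_tail hd).comp tendsto_nat_floor_atTop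
  have hratio : Tendsto (fun x => x / dinv (d ⌊x⌋₊)) atTop (𝓝 1) :=
    (isEquivalent_iff_tendsto_one ((hT.comp hdinf).eventually_ne_atTop 0)).1 hdinv₂.symm
  -- Passage from the scale `t` to the scale `x` by `t = d ⌊x⌋₊`, where `dinv t ~ x`.
  have hrescale : ∀ {g : ℝ → ℝ} {L : ℝ}, Tendsto (fun t => dinv t * g t) atTop (𝓝 L) →
      Tendsto (fun x => x * g (d ⌊x⌋₊)) atTop (𝓝 L) := by
    intro g L h
    have := hratio.mul (h.comp hdinf)
    rw [one_mul] at this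
    refine this.congr' ?_
    filter_upwards [hdinf.eventually hT0] with x hx
    simp only [Function.comp_apply]
    field_simp
  have hUX := tendsto_mul_tail_genInverse (P := P) hX fun c hc => ⟨_, hMX c hc⟩
  have hUY := tendsto_mul_tail_genInverse (P := P) hY fun c hc => ⟨_, hrescale (hB c hc)⟩
  rw [tendsto_cond_iff_tendsto_mul (fun x => measurableSet_lt measurable_const hY) hUY]
  constructor
  · intro hV
    refine tendsto_joint_tail_congr hX hY (hrescale (hA 1 one_pos)) hUX
      (hrescale (hB 1 one_pos)) hUY ?_
    exact hrescale (joint_of_vagueTendsto hα0 hX hY ha hT0 hV one_pos (hB 1 one_pos))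
  · intro hC
    refine vagueTendsto_of_joint hα0 hX hY ha hT0 hA hB fun w hw => ?_
    -- At `x = dinv t / w` the prefactor `dinv t` is `w * x`, so limits 1 in `x` become limits `w`
    -- in `t`.
    have hdiv : Tendsto (fun t => dinv t / w) atTop atTop := hT.atTop_div_const hw
    have hscale : ∀ {g : ℝ → ℝ}, Tendsto (fun x => x * g x) atTop (𝓝 1) →
        Tendsto (fun t => dinv t * g (dinv t / w)) atTop (𝓝 w) := by
      intro g h
      have := (h.comp hdiv).const_mul w
      rw [mul_one] at this
      refine this.congr fun t => ?_
      simp only [Function.comp_apply]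
      field_simp
    exact tendsto_joint_tail_congr hX hY (hscale hUX) (hA w hw) (hscale hUY) (hB w hw) (hscale hC)

end FullTailDependence

theorem mainTheorem4 {Ω : Type*} [MeasurableSpace Ω] (P : Measure Ω) [IsProbabilityMeasure P]
    (X Y : Ω → ℝ) (hX : Measurable X) (hY : Measurable Y) (hY0 : ∀ᵐ ω ∂P, 0 ≤ Y ω)
    (α : ℝ) (hα0 : 0 < α) (hα1 : α < 1) (G : FullTailDependence.ExtremeLaw)
    (a b : ℝ → ℝ) (hMDA : FullTailDependence.IsInMDA P X G a b)
    (hReg : FullTailDependence.IsRegVar P Y α)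
    (d : ℕ → ℝ) (hd0 : d 0 = 0) (hdpos : ∀ n : ℕ, 1 ≤ n → 0 < d n)
    (hd : Tendsto (fun n : ℕ => (n : ℝ) * (1 - cdf (P.map Y) (d n))) atTop (𝓝 1))
    (dinv : ℝ → ℝ)
    (hdinv₁ : (fun t : ℝ => d ⌊dinv t⌋₊) ~[atTop] (fun t : ℝ => t))
    (hdinv₂ : (fun t : ℝ => dinv (d ⌊t⌋₊)) ~[atTop] (fun t : ℝ => t)) :
    FullTailDependence.VagueTendsto
        (fun t : ℝ => ENNReal.ofReal (dinv t) •
          FullTailDependence.rescaledLaw P X Y G a b dinv t)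
        (FullTailDependence.exponentMeasure α G) ↔
      Tendsto
        (fun x : ℝ =>
          ProbabilityTheory.cond P
            {ω | FullTailDependence.genInverse (FullTailDependence.tailRecip P Y) x < Y ω}
            {ω | FullTailDependence.genInverse (FullTailDependence.tailRecip P X) x < X ω})
        atTop (𝓝 1) :=
  FullTailDependence.vagueTendsto_iff_tendsto_cond hX hY hα0 hMDA hReg hd hdinv₁ hdinv₂
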